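/- Let $D\ge 0$ be an even integer, let $\mathbb F$ be the field with two elements, and for every integer $n\ge 0$ let $V_n$ be the $\mathbb F$-vector space with basis $e_1,\dots,e_n$. For integers $a\le b$ write $[a,b]=\{a,a+1,\dots,b\}$, and for $I\subseteq[1,n]$ write $e_I=\sum_{i\in I}e_i\in V_n$. **The collection $\mathcal F(V_D)$.** For $n\ge2$ and $i\in[1,n]$ let $T_i:V_{n-2}\to V_n$ be the linear map with $T_i(e_k)=e_k$ if $k\le i-2$, $T_i(e_k)=e_{k+2}$ if $k\ge i$, and $T_i(e_{i-1})=e_{i-1}+e_i+e_{i+1}$ if $1<i<n$. Let $\mathcal F(V_0)=\{0\}$ and, for even $n\ge2$, let $\mathcal F(V_n)$ consist of $0$ and of all subspaces $T_i(E')\oplus\mathbb F e_i$ with $i\in[1,n]$, $E'\in\mathcal F(V_{n-2})$. Every $E\in\mathcal F(V_D)$ has $\dim E\le D/2$; let $\Delta=\Delta_E=D-2\dim E$. Let $\underline{\mathcal F}$ be the set of pairs $(E,k)$ with $E\in\mathcal F(V_D)$ and $k\in[0,\Delta_E/2]$. **The vectors $v^k_E$.** For $E\in\mathcal F(V_D)$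 let $\sigma\subseteq[1,D]$ be the union of all intervals $[a,b]\subseteq[1,D]$ with $e_{[a,b]}\in E$. There are exactly $\Delta+1$ integers $j\in[0,D]$ with $j\notin\sigma$ and $j+1\notin\sigma$; write them as $j_0<j_1<\dots<j_\Delta$ and let $I_c=[j_{c-1}+1,j_c]$ for $c\in[1,\Delta]$. For $k\in[0,\Delta/2]$ and $m\in[1,k]$ let $J_m$ be the complement of $[m,\Delta+1-m]$ in $[0,\Delta]$ (here $0$ serves as an extra symbol); for $c\in[0,\Delta]$ let $n_c$ be the number of $m\in[1,k]$ with $c\in J_m$, and let $\epsilon^c\in\mathbb F$ be $n_c(n_c+1)/2$ modulo $2$. Define $$v^k_E=\sum_{c\in[1,\Delta]}(\epsilon^c+\epsilon^0)\,e_{I_c}\in V_D .$$ **The function $\tilde u$.** Every $x\in V_D$ can be written uniquely as $x=e_{[a_1,b_1]}+\dots+e_{[a_r,b_r]}$ with $1\le a_1\le b_1$, $b_{s}+2\le a_{s+1}\le b_{s+1}$ for $1\le s<r$, and $b_r\le D$. Let $u(x)=\sum(-1)^{a_s}$, the sum over all $s\in[1,r]$ with $a_s\not\equiv b_s\pmod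 2$, and let $\tilde u(x)=2u(x)$ if $u(x)\ge0$, $\tilde u(x)=-2u(x)-1$ if $u(x)<0$. This defines $\tilde u:V_D\to\mathbb N$. Let $\mathbb C[V_D]$ be the space of formal $\mathbb C$-linear combinations of elements of $V_D$, and for $k\in\mathbb N$ let $\mathbb C[V_D]_k$ be the subspace of those supported on $\tilde u^{-1}(k)$. For $(E,k)\in\underline{\mathcal F}$ let $f^k_E=\sum_{v\in E+v^k_E}v\in\mathbb C[V_D]$. Then: 1. For every $k\in\mathbb N$, the elements $f^k_E$ with $E\in\mathcal F(V_D)$, $(E,k)\in\underline{\mathcal F}$, form a $\mathbb C$-basis of $\mathbb C[V_D]_k$. 2. The elements $f^k_E$ with $(E,k)\in\underline{\mathcal F}$ form a $\mathbb C$-basis of $\mathbb C[V_D]$. 3. For every $k\in\mathbb N$, the set $\tilde u^{-1}(k)$ is the union of the affine subspaces $E+v^k_E$ where $E$ runs over all members of $\mathcal F(V_D)$ of dimension $D/2-k$ (for $k>D/2$ both sides are empty). -/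

import Mathlib

namespace ThirdBasis

noncomputable section

/-- The vector space `V_D` over the field with two elements with basis `e_1, …, e_D`; the
coordinate along `e_i` (`1 ≤ i ≤ D`) is the value at the element `i - 1` of `Fin D`. -/
abbrev V (D : ℕ) : Type := Fin D → ZMod 2

/-- The vector `e_[a,b] = e_a + e_{a+1} + ⋯ + e_b` of `V_D`, for `1 ≤ a ≤ b ≤ D`. -/
def eInt (D a b : ℕ) : V D := fun j => if a ≤ (j : ℕ) + 1 ∧ (j : ℕ) + 1 ≤ b then 1 else 0

/-- The basis vector `e_i` of `V_D`, for `1 ≤ i ≤ D`. -/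
def e (D i : ℕ) : V D := eInt D i i

/-- The linear map `T_i : V_D → V_{D+2}`, for `1 ≤ i ≤ D + 2`:
`e_k ↦ e_k` if `k ≤ i - 2`, `e_k ↦ e_{k+2}` if `k ≥ i`, and
`e_{i-1} ↦ e_{i-1} + e_i + e_{i+1}`. (Below, `k = j + 1` for `j : Fin D`.) -/
def T (D i : ℕ) : V D →ₗ[ZMod 2] V (D + 2) :=
  (Pi.basisFun (ZMod 2) (Fin D)).constr ℕ fun j =>
    if (j : ℕ) + 1 + 2 ≤ i then e (D + 2) ((j : ℕ) + 1)
    else if i ≤ (j : ℕ) + 1 then e (D + 2) ((j : ℕ) + 1 + 2)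
    else e (D + 2) (i - 1) + e (D + 2) i + e (D + 2) (i + 1)

/-- `IsF D E` says that the subspace `E` of `V_D` belongs to the collection `𝓕(V_D)`, defined
inductively: `𝓕(V_0) = {0}`, `𝓕(V_1) = {0, V_1}`, and for `D ≥ 2` the members of `𝓕(V_D)` are `0`
and the subspaces `T_i(E') ⊕ 𝔽 e_i` with `i ∈ [1, D]`, `E' ∈ 𝓕(V_{D-2})`. (The sum is
automatically direct, as `e_i` is never in the image of `T_i`.) -/
inductive IsF : (D : ℕ) → Submodule (ZMod 2) (V D) → Prop
  | zero (D : ℕ) : IsF D ⊥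
  | one : IsF 1 ⊤
  | step (D i : ℕ) (E' : Submodule (ZMod 2) (V D)) (h1 : 1 ≤ i) (h2 : i ≤ D + 2)
      (hE' : IsF D E') :
      IsF (D + 2) (E'.map (T D i) ⊔ Submodule.span (ZMod 2) {e (D + 2) i})

/-- The integer `D - 2 dim E`. -/
def defect {D : ℕ} (E : Submodule (ZMod 2) (V D)) : ℕ := D - 2 * Module.finrank (ZMod 2) E

/-- For even `D`: the set of all pairs `(E, k)` with `E ∈ 𝓕(V_D)` and `0 ≤ k ≤ D/2 - dim E`. -/
def IsPair (D : ℕ) (E : Submodule (ZMod 2) (V D)) (k : ℕ) : Prop :=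
  IsF D E ∧ 2 * Module.finrank (ZMod 2) E + 2 * k ≤ D

/-! ### The complement of `E` in its orthogonal space and its canonical basis -/

/-- The set `B_E` of all intervals `[a,b] ⊆ [1,D]`, written as pairs `(a, b)`, with
`e_[a,b] ∈ E`. For `E ∈ 𝓕(V_D)` the vectors `e_[a,b]`, `(a, b) ∈ B_E`, form a basis of `E`. -/
def intervals {D : ℕ} (E : Submodule (ZMod 2) (V D)) : Set (ℕ × ℕ) :=
  {p | 1 ≤ p.1 ∧ p.1 ≤ p.2 ∧ p.2 ≤ D ∧ eInt D p.1 p.2 ∈ E}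

/-- The subset `σ` of `[1, D]`: the union of the intervals in `B_E`. -/
def sigma {D : ℕ} (E : Submodule (ZMod 2) (V D)) : Set ℕ :=
  {j | ∃ p ∈ intervals E, p.1 ≤ j ∧ j ≤ p.2}

/-- A cut of `E` is an integer `j ∈ [0, D]` such that neither `j` nor `j + 1` is in `σ` (note that
`0` and `D + 1` are never in `σ`). -/
def IsCut {D : ℕ} (E : Submodule (ZMod 2) (V D)) (j : ℕ) : Prop :=
  j ≤ D ∧ j ∉ sigma E ∧ j + 1 ∉ sigma E

/-- The vector `e_{I_c}` of `V_D`, for `1 ≤ c ≤ Δ = D - 2 dim E`. If `j_0 < j_1 < ⋯ < j_Δ` are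
the cuts of `E` then `I_c = [j_{c-1} + 1, j_c]`. In other words: write `σ` as the union of its
maximal intervals `[a_1, b_1], …, [a_s, b_s]` (in increasing order) and put `b_0 = -1`,
`a_{s+1} = D + 2`; let `i_1 < ⋯ < i_t` be the indices `i ∈ [1, s+1]` with `a_i - b_{i-1} ≥ 3`.
Then `I_1, …, I_Δ` are, from left to right, the intervals `[a_{i_u} - 1, b_{i_{u+1} - 1} + 1]`
with `u ∈ [1, t-1]` together with the one-element intervals `{j}` with
`b_{i-1} + 2 ≤ j ≤ a_i - 2` for some `i ∈ [1, s+1]`. -/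
def eI {D : ℕ} (E : Submodule (ZMod 2) (V D)) (c : ℕ) : V D :=
  eInt D (Nat.nth (IsCut E) (c - 1) + 1) (Nat.nth (IsCut E) c)

/-- The linear map `V_Δ → V_D`, `e_c ↦ e_{I_c}` (`Δ = D - 2 dim E`), which identifies `V_Δ` with
the subspace `𝔗_E` of `V_D` with basis `e_{I_1}, …, e_{I_Δ}`. -/
def tau {D : ℕ} (E : Submodule (ZMod 2) (V D)) : V (defect E) →ₗ[ZMod 2] V D :=
  (Pi.basisFun (ZMod 2) (Fin (defect E))).constr ℕ fun c => eI E ((c : ℕ) + 1)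

/-! ### The vector attached to a set of intervals (even dimension)

The extended index set `[1, D] ⊔ {𝐚}` is modelled by `{0, 1, …, D}`, the number `0` playing the
role of the additional symbol `𝐚`. -/

/-- `I ↦ I^*`: `I^* = I` if `|I|` is odd, and the complement of `I` in `[1, D] ⊔ {𝐚}` if `|I|` is
even. -/
def star (D : ℕ) (I : Finset ℕ) : Finset ℕ :=
  if Odd I.card then I else Finset.range (D + 1) \ I

/-- The number `n_j(B)` of `I ∈ B` containing `j`. -/
def nCount (B : Finset (Finset ℕ)) (j : ℕ) : ℕ := (B.filter fun I => j ∈ I).card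

/-- `ε^j(B) = n_j(B) (n_j(B) + 1) / 2` modulo `2`. -/
def epsCoeff (B : Finset (Finset ℕ)) (j : ℕ) : ZMod 2 :=
  ((nCount B j * (nCount B j + 1) / 2 : ℕ) : ZMod 2)

/-- The vector `ε_D(B) = ∑_j ε^j(B) e_j` of `V_D`, with `j` running over `[1, D] ⊔ {𝐚}` and
`e_𝐚 = e_[1,D]`. -/
def epsVec (D : ℕ) (B : Finset (Finset ℕ)) : V D :=
  (∑ j ∈ Finset.Icc 1 D, epsCoeff B j • e D j) + epsCoeff B 0 • eInt D 1 D

/-- The primitive set of intervals `{[1, D], [2, D-1], …, [k, D+1-k]}`, for `0 ≤ k ≤ D/2`. -/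
def prim (D k : ℕ) : Finset (Finset ℕ) :=
  (Finset.Icc 1 k).image fun m => Finset.Icc m (D + 1 - m)

/-- The vector `v^k_E ∈ 𝔗_E ⊆ V_D`, for `(E, k)` with `0 ≤ k ≤ Δ/2`: the element which corresponds,
under the identification of `𝔗_E` with `V_Δ`, to the vector `ε_Δ(B^*)` of the primitive set of
intervals `B = {[1, Δ], …, [k, Δ+1-k]}`, where `B^* = {I^* ; I ∈ B}`. -/
def vVec {D : ℕ} (E : Submodule (ZMod 2) (V D)) (k : ℕ) : V D :=
  tau E (epsVec (defect E) ((prim (defect E) k).image (star (defect E))))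

/-- The affine subspace `E + v^k_E` of `V_D`. -/
def coset {D : ℕ} (E : Submodule (ZMod 2) (V D)) (k : ℕ) : Set (V D) :=
  (fun x => x + vVec E k) '' (E : Set (V D))

/-! ### The function `ũ` -/

/-- The coefficient of `e_j` in `x`, which is `0` when `j ∉ [1, D]`. -/
def coeff {D : ℕ} (x : V D) (j : ℕ) : ZMod 2 :=
  if h : 1 ≤ j ∧ j ≤ D then x ⟨j - 1, by omega⟩ else 0

/-- `[a, b]` is one of the intervals in the unique decomposition
`x = e_[a_1,b_1] + ⋯ + e_[a_r,b_r]` with `1 ≤ a_1 ≤ b_1`, `b_1 + 2 ≤ a_2 ≤ b_2`, …,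
`b_{r-1} + 2 ≤ a_r ≤ b_r ≤ D`, that is, a maximal interval in the support of `x`. -/
def IsRun {D : ℕ} (x : V D) (a b : ℕ) : Prop :=
  1 ≤ a ∧ a ≤ b ∧ b ≤ D ∧ (∀ j, a ≤ j → j ≤ b → coeff x j = 1) ∧
    coeff x (a - 1) = 0 ∧ coeff x (b + 1) = 0

open Classical in
/-- `u(x)` is the sum of `(-1)^{a_s}` over those intervals `[a_s, b_s]` of the decomposition of `x`
for which `a_s` and `b_s` have different parity. -/
def u {D : ℕ} (x : V D) : ℤ :=
  ∑ p ∈ (Finset.Icc 1 D ×ˢ Finset.Icc 1 D).filter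
    (fun p => IsRun x p.1 p.2 ∧ p.1 % 2 ≠ p.2 % 2), (-1 : ℤ) ^ p.1

/-- For even `D`: `ũ(x) = 2u(x)` if `u(x) ≥ 0` and `ũ(x) = -2u(x) - 1` if `u(x) < 0`. -/
def uTilde {D : ℕ} (x : V D) : ℕ := if 0 ≤ u x then (2 * u x).toNat else (-2 * u x - 1).toNat

/-- The fibre of `ũ` over `k`. -/
def level (D k : ℕ) : Set (V D) := {x | uTilde x = k}

/-! ### Formal linear combinations -/

/-- The subspace of `ℂ[V_D]` of all formal linear combinations supported on the fibre of `ũ`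
over `k`. -/
def CV (D k : ℕ) : Submodule ℂ (V D →₀ ℂ) := Finsupp.supported ℂ ℂ (level D k)

open Classical in
/-- The element `f^k_E` of `ℂ[V_D]`: the sum of all elements of `E + v^k_E`. -/
def f {D : ℕ} (E : Submodule (ZMod 2) (V D)) (k : ℕ) : V D →₀ ℂ :=
  ∑ v ∈ Finset.univ.filter (fun v => v ∈ coset E k), Finsupp.single v 1

end

end ThirdBasis

/-!
A vector `x` of `V_D` is turned into a lattice path with `D + 1` steps `±1`, the sign of a step
recording whether two neighbouring coordinates of `x` agree, twisted by the parity of the place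
(`height`). A run of `x` with ends of different parity contributes to the end of the path, the
other runs do not, so that the path ends at `-1 - 4 u(x)`, of absolute value `2 ũ(x) + 1`
(`two_mul_u`, `natAbs_height_end`). The fibre of `ũ` over `k` thus consists of all paths with one
prescribed end, and the two vectors `T_i x + c e_i` arise from `x` by inserting a peak or a valley
at `i`; in particular they have the same `ũ` as `x`.

The whole configuration is compatible with this insertion: the cuts of `T_i(E) ⊕ 𝔽 e_i` are the
shifted cuts of `E`, hence `v^k` of the extension is `T_i(v^k_E)` (`vVec_extend`), the coset of the
extension is obtained from `E + v^k_E` by insertion (`mem_coset_extend`), and `f^k` of the extension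
is the image of `f^k_E` under a linear map `cup` (`f_extend`). For `E = 0` the path of `v^k_0` is
explicit and gives `ũ(v^k_0) = k`; by induction `ũ = k` on every coset `E + v^k_E`. Conversely,
insertions can be undone in any `x` with equal coordinates at some `i - 1` and `i + 1`, and the only
vector of `V_D` without such `i` is `v^{D/2}_0`; this describes the fibres as unions of cosets
(`level_eq_iUnion_coset`).

Spanning (`fSpan_eq_CV`): if `x` has equal coordinates at `i - 1` and `i + 1`, then `x` and
`x + e_i` are the two insertions into a shorter vector, and their sum is in the image of `cup`,
hence in the span of the `f^k_E` by induction. Replacing `x` by `x + e_i` at a peak lowers the area under the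
path, and a fibre contains only one vector without peaks (`eq_of_peakless`). Hence all vectors of a
fibre agree up to sign modulo the span, which also contains the vector `v^k_0 = f^k_0`.

Independence (`linearIndependent_pairs`) follows by counting, since there are at most `2^D` pairs
`(E, k)`. Matching the up steps of a path with the down steps that return to the same height gives
a subspace `arcSpan x`. Inserting a peak into the path extends this subspace, and without peaks it
is `0`, so that every pair is of the form `(arcSpan x, ũ(x))` for some `x` (`exists_arcSpan_eq`).
-/

namespace ThirdBasis

/-! ### Coordinates and the maps `T_i` -/

lemma zmod_two_cases (z : ZMod 2) : z = 0 ∨ z = 1 := by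
  revert z; decide

lemma coeff_zero_index {D : ℕ} (x : V D) : coeff x 0 = 0 := by simp [coeff]

lemma coeff_of_lt {D : ℕ} (x : V D) {j : ℕ} (h : D < j) : coeff x j = 0 := by
  rw [coeff, dif_neg]; omega

lemma coeff_add {D : ℕ} (x y : V D) (j : ℕ) : coeff (x + y) j = coeff x j + coeff y j := by
  unfold coeff; split_ifs <;> simp

lemma coeff_smul {D : ℕ} (c : ZMod 2) (x : V D) (j : ℕ) : coeff (c • x) j = c * coeff x j := by
  unfold coeff; split_ifs <;> simp

lemma coeff_zero {D : ℕ} (j : ℕ) : coeff (0 : V D) j = 0 := by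
  unfold coeff; split_ifs <;> simp

lemma coeff_sum {D : ℕ} {ι : Type*} (s : Finset ι) (g : ι → V D) (j : ℕ) :
    coeff (∑ c ∈ s, g c) j = ∑ c ∈ s, coeff (g c) j := by
  unfold coeff; split_ifs <;> simp

lemma coeff_succ_eq {D : ℕ} (x : V D) (j : Fin D) : coeff x ((j : ℕ) + 1) = x j := by
  rw [coeff, dif_pos ⟨by omega, j.2⟩]; rfl

lemma ext_coeff {D : ℕ} {x y : V D} (h : ∀ j, 1 ≤ j → j ≤ D → coeff x j = coeff y j) : x = y := by
  funext j
  rw [← coeff_succ_eq x, ← coeff_succ_eq y]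
  exact h _ (by omega) j.2

lemma coeff_eInt {D a b j : ℕ} :
    coeff (eInt D a b) j = if 1 ≤ j ∧ j ≤ D ∧ a ≤ j ∧ j ≤ b then 1 else 0 := by
  by_cases h : 1 ≤ j ∧ j ≤ D
  · have : j - 1 + 1 = j := by omega
    simp [coeff, h, eInt, this]
  · rw [coeff, dif_neg h, if_neg]; omega

lemma coeff_e {D i j : ℕ} : coeff (e D i) j = if 1 ≤ j ∧ j ≤ D ∧ j = i then 1 else 0 := by
  rw [e, coeff_eInt]; congr 1; simp only [eq_iff_iff]; omega

lemma coeff_T {D i : ℕ} (h1 : 1 ≤ i) (h2 : i ≤ D + 2) (x : V D) (j : ℕ) :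
    coeff (T D i x) j =
      if j < i then coeff x j else if j = i then coeff x (i - 1) else coeff x (j - 2) := by
  have key : ∀ k : Fin D, ∀ j, coeff (T D i (Pi.single k 1)) j =
      if j < i then coeff (Pi.single k 1 : V D) j else if j = i then
        coeff (Pi.single k 1 : V D) (i - 1) else coeff (Pi.single k 1 : V D) (j - 2) := by
    intro k j
    have hs : (Pi.single k 1 : V D) = e D (k + 1) := by
      apply ext_coeff
      intro l hl hlD
      rw [coeff_e, coeff, dif_pos ⟨hl, hlD⟩, Pi.single_apply]
      congr 1
      simp only [Fin.ext_iff, eq_iff_iff]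
      omega
    have hT : T D i (Pi.single k 1) =
      if (k : ℕ) + 1 + 2 ≤ i then e (D + 2) ((k : ℕ) + 1)
        else if i ≤ (k : ℕ) + 1 then e (D + 2) ((k : ℕ) + 1 + 2)
        else e (D + 2) (i - 1) + e (D + 2) i + e (D + 2) (i + 1) := by
      rw [← Pi.basisFun_apply, T, Module.Basis.constr_basis]
    rw [hT, hs]
    have := k.2
    split_ifs <;> simp only [coeff_add, coeff_e] <;> split_ifs <;> first | rfl | omega
  have hx : x = ∑ k, x k • (Pi.single k 1 : V D) := by
    funext l
    simp [Finset.sum_apply, Pi.single_apply]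
  rw [hx, map_sum]
  simp only [map_smul, coeff_sum, coeff_smul, key]
  split_ifs <;> rfl

/-- The vector `T_i x + c e_i` of `V_{D+2}`. -/
noncomputable def ins {D : ℕ} (i : ℕ) (x : V D) (c : ZMod 2) : V (D + 2) :=
  T D i x + c • e (D + 2) i

lemma coeff_ins_of_lt {D i j : ℕ} (h1 : 1 ≤ i) (h2 : i ≤ D + 2) (x : V D) (c : ZMod 2)
    (h : j < i) : coeff (ins i x c) j = coeff x j := by
  rw [ins, coeff_add, coeff_smul, coeff_T h1 h2, coeff_e, if_pos h, if_neg (by omega)]; simp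

lemma coeff_ins_self {D i : ℕ} (h1 : 1 ≤ i) (h2 : i ≤ D + 2) (x : V D) (c : ZMod 2) :
    coeff (ins i x c) i = coeff x (i - 1) + c := by
  rw [ins, coeff_add, coeff_smul, coeff_T h1 h2, coeff_e, if_neg (by omega), if_pos rfl,
    if_pos (by omega)]; simp

lemma coeff_ins_of_gt {D i j : ℕ} (h1 : 1 ≤ i) (h2 : i ≤ D + 2) (x : V D) (c : ZMod 2)
    (h : i < j + 2) : coeff (ins i x c) (j + 2) = coeff x j := by
  rw [ins, coeff_add, coeff_smul, coeff_T h1 h2, coeff_e, if_neg (by omega), if_neg (by omega),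
    if_neg (by omega)]; simp

lemma exists_eq_ins {D i : ℕ} (h1 : 1 ≤ i) (h2 : i ≤ D + 2) (x : V (D + 2))
    (h : coeff x (i - 1) = coeff x (i + 1)) : ∃ x' c, x = ins i x' c := by
  set x' : V D := fun k => if (k : ℕ) + 1 < i then coeff x (k + 1) else coeff x (k + 3) with hx'
  have hc : ∀ j, 1 ≤ j → j ≤ D → coeff x' j = if j < i then coeff x j else coeff x (j + 2) := by
    intro j hj hjD
    rw [coeff, dif_pos ⟨hj, hjD⟩]
    simp only [hx', show j - 1 + 1 = j by omega, show j - 1 + 3 = j + 2 by omega]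
  refine ⟨x', coeff x i + coeff x' (i - 1), ext_coeff fun j hj hjD => ?_⟩
  rcases lt_trichotomy j i with hji | rfl | hji
  · rw [coeff_ins_of_lt h1 h2 _ _ hji]
    by_cases hD : j ≤ D
    · rw [hc j hj hD, if_pos hji]
    · obtain rfl : j = D + 1 := by omega
      obtain rfl : i = D + 2 := by omega
      rw [coeff_of_lt x' (by omega)]
      simpa [coeff_of_lt x (show D + 2 < D + 3 by omega)] using h
  · rw [coeff_ins_self h1 h2]
    rcases zmod_two_cases (coeff x j) with h | h <;>
      rcases zmod_two_cases (coeff x' (j - 1)) with h' | h' <;> rw [h, h'] <;> decide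
  · obtain ⟨l, rfl⟩ : ∃ l, j = l + 2 := ⟨j - 2, by omega⟩
    rw [coeff_ins_of_gt h1 h2 _ _ hji]
    by_cases hl : l = 0
    · subst hl
      obtain rfl : i = 1 := by omega
      simpa [coeff_zero_index] using h.symm
    · rw [hc l (by omega) (by omega)]
      split_ifs with hli
      · obtain rfl : i = l + 1 := by omega
        exact h.symm
      · rfl

lemma ins_injective {D i : ℕ} (h1 : 1 ≤ i) (h2 : i ≤ D + 2) {x y : V D} {c d : ZMod 2}
    (h : ins i x c = ins i y d) : x = y ∧ c = d := by
  have hxy : x = y := by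
    apply ext_coeff
    intro j hj hjD
    by_cases hji : j < i
    · rw [← coeff_ins_of_lt h1 h2 x c hji, h, coeff_ins_of_lt h1 h2 y d hji]
    · have hji : i < j + 2 := by omega
      rw [← coeff_ins_of_gt h1 h2 x c hji, h, coeff_ins_of_gt h1 h2 y d hji]
  refine ⟨hxy, ?_⟩
  have := coeff_ins_self h1 h2 x c
  rw [h, coeff_ins_self h1 h2, hxy] at this
  exact (add_left_cancel this).symm

lemma ins_add {D i : ℕ} (x y : V D) (c d : ZMod 2) :
    ins i (x + y) (c + d) = ins i x c + ins i y d := by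
  rw [ins, ins, ins, map_add, add_smul]; abel

lemma ins_zero_right {D i : ℕ} (x : V D) : ins i x 0 = T D i x := by simp [ins]

/-- The subspace `T_i(E) + 𝔽 e_i` of `V_{D+2}`. -/
noncomputable def extend {D : ℕ} (i : ℕ) (E : Submodule (ZMod 2) (V D)) :
    Submodule (ZMod 2) (V (D + 2)) :=
  E.map (T D i) ⊔ Submodule.span (ZMod 2) {e (D + 2) i}

lemma mem_extend {D i : ℕ} {E : Submodule (ZMod 2) (V D)} {x : V (D + 2)} :
    x ∈ extend i E ↔ ∃ x' ∈ E, ∃ c, ins i x' c = x := by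
  rw [extend, Submodule.mem_sup]
  constructor
  · rintro ⟨y, ⟨x', hx', rfl⟩, z, hz, rfl⟩
    obtain ⟨c, rfl⟩ := Submodule.mem_span_singleton.1 hz
    exact ⟨x', hx', c, rfl⟩
  · rintro ⟨x', hx', c, rfl⟩
    exact ⟨_, ⟨x', hx', rfl⟩, _, Submodule.mem_span_singleton.2 ⟨c, rfl⟩, rfl⟩

lemma T_injective {D i : ℕ} (h1 : 1 ≤ i) (h2 : i ≤ D + 2) : Function.Injective (T D i) := by
  intro x y h
  rw [← ins_zero_right, ← ins_zero_right] at h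
  exact (ins_injective h1 h2 h).1

lemma finrank_extend {D i : ℕ} (h1 : 1 ≤ i) (h2 : i ≤ D + 2) (E : Submodule (ZMod 2) (V D)) :
    Module.finrank (ZMod 2) (extend i E) = Module.finrank (ZMod 2) E + 1 := by
  have hne : e (D + 2) i ≠ 0 := by
    intro h
    have := coeff_e (D := D + 2) (i := i) (j := i)
    rw [h, coeff_zero, if_pos (by omega)] at this
    exact zero_ne_one this
  have hinf : E.map (T D i) ⊓ Submodule.span (ZMod 2) {e (D + 2) i} = ⊥ := by
    rw [eq_bot_iff]
    rintro _ ⟨⟨x, -, rfl⟩, hz⟩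
    obtain ⟨c, hc⟩ := Submodule.mem_span_singleton.1 hz
    have : ins i (0 : V D) c = ins i x 0 := by rw [ins_zero_right, ← hc]; simp [ins]
    rw [← (ins_injective h1 h2 this).1]
    simp
  have := Submodule.finrank_sup_add_finrank_inf_eq (E.map (T D i))
    (Submodule.span (ZMod 2) {e (D + 2) i})
  rw [hinf, finrank_bot, finrank_span_singleton hne,
    ← (Submodule.equivMapOfInjective _ (T_injective h1 h2) E).finrank_eq] at this
  exact this

/-- The members of `𝓕(V_D)`, `D` even, are obtained from `0` by repeated extension; the exceptional
member in dimension one does not occur. -/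
lemma IsF.even_induction {P : ∀ D : ℕ, Submodule (ZMod 2) (V D) → Prop}
    (bot : ∀ D, Even D → P D ⊥)
    (step : ∀ (D i : ℕ) (E : Submodule (ZMod 2) (V D)), Even D → 1 ≤ i → i ≤ D + 2 → IsF D E →
      P D E → P (D + 2) (extend i E))
    {D : ℕ} {E : Submodule (ZMod 2) (V D)} (hD : Even D) (hE : IsF D E) : P D E := by
  induction hE with
  | zero D => exact bot D hD
  | one => exact absurd hD (by decide)
  | step D i E' h1 h2 hE' ih =>
    have hD' : Even D := (Nat.even_add.1 hD).2 (by decide)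
    exact step D i E' hD' h1 h2 hE' (ih hD')

lemma IsF.extend {D i : ℕ} (h1 : 1 ≤ i) (h2 : i ≤ D + 2) {E : Submodule (ZMod 2) (V D)}
    (hE : IsF D E) : IsF (D + 2) (extend i E) :=
  IsF.step D i E h1 h2 hE

/-- The effect of `T_i` on the numbers `j` that separate the places `j` and `j + 1`: those
below `i - 1` are kept, the others move up by two. -/
def shift (i j : ℕ) : ℕ := if j + 2 ≤ i then j else j + 2

lemma shift_strictMono (i : ℕ) : StrictMono (shift i) := by
  intro a b h
  unfold shift; split_ifs <;> omega

lemma T_eInt {D i a b : ℕ} (h1 : 1 ≤ i) (h2 : i ≤ D + 2) (hb : b ≤ D) :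
    T D i (eInt D (a + 1) b) = eInt (D + 2) (shift i a + 1) (shift i b) := by
  apply ext_coeff
  intro j hj hjD
  rw [coeff_T h1 h2]
  simp only [coeff_eInt, shift]
  split_ifs <;> first | rfl | omega

/-! ### Cuts and the vectors `v^k_E` -/

/-- The set `σ` is the union of the supports of all vectors of `E`, because `E` is spanned by
interval vectors. -/
lemma mem_sigma_iff {D : ℕ} {E : Submodule (ZMod 2) (V D)} (hD : Even D) (hE : IsF D E) (j : ℕ) :
    j ∈ sigma E ↔ ∃ x ∈ E, coeff x j ≠ 0 := by
  constructor
  · rintro ⟨⟨a, b⟩, ⟨h1, -, h3, h4⟩, h5, h6⟩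
    refine ⟨_, h4, ?_⟩
    simp only at h1 h3 h5 h6
    rw [coeff_eInt, if_pos (by omega)]
    exact one_ne_zero
  · refine IsF.even_induction
      (P := fun D E => ∀ j, (∃ x ∈ E, coeff x j ≠ 0) → j ∈ sigma E) ?_ ?_ hD hE j
    · rintro D - j ⟨x, hx, hj⟩
      rw [(Submodule.mem_bot _).1 hx, coeff_zero] at hj
      exact absurd rfl hj
    · rintro D i E - h1 h2 hE ih j ⟨_, hx, hj⟩
      obtain ⟨x, hxE, c, rfl⟩ := mem_extend.1 hx
      by_cases hji : j = i
      · exact ⟨(i, i), ⟨h1, le_rfl, h2,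
          mem_extend.2 ⟨0, E.zero_mem, 1, by simp [ins, e]⟩⟩, hji.ge, hji.le⟩
      -- the place of `V_D` whose coordinate is carried to the place `j`
      obtain ⟨l, hl, hjl⟩ : ∃ l, coeff x l ≠ 0 ∧ (j < i ∧ l = j ∨ i < j ∧ j = l + 2) := by
        rcases Nat.lt_or_gt_of_ne hji with h | h
        · exact ⟨j, by rwa [coeff_ins_of_lt h1 h2 _ _ h] at hj, Or.inl ⟨h, rfl⟩⟩
        · obtain ⟨l, rfl⟩ : ∃ l, j = l + 2 := by
            refine ⟨j - 2, ?_⟩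
            by_contra hcon
            obtain rfl : j = 1 := by omega
            omega
          exact ⟨l, by rwa [coeff_ins_of_gt h1 h2 _ _ h] at hj, Or.inr ⟨h, rfl⟩⟩
      obtain ⟨⟨a, b⟩, ⟨ha, hab, hb, hmem⟩, hal, hlb⟩ := ih l ⟨x, hxE, hl⟩
      obtain ⟨a, rfl⟩ : ∃ a', a = a' + 1 := ⟨a - 1, by simp only at ha; omega⟩
      simp only at ha hab hb hmem hal hlb
      refine ⟨(shift i a + 1, shift i b), ⟨by simp, ?_, ?_, ?_⟩, ?_, ?_⟩
      · exact shift_strictMono i (show a < b by omega)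
      · simp only [shift]; split_ifs <;> omega
      · exact mem_extend.2 ⟨_, hmem, 0, by rw [ins_zero_right, T_eInt h1 h2 hb]⟩
      all_goals simp only [shift]; split_ifs <;> omega

lemma isCut_iff {D : ℕ} {E : Submodule (ZMod 2) (V D)} (hD : Even D) (hE : IsF D E) (j : ℕ) :
    IsCut E j ↔ j ≤ D ∧ ∀ x ∈ E, coeff x j = 0 ∧ coeff x (j + 1) = 0 := by
  simp only [IsCut, mem_sigma_iff hD hE, not_exists, not_and, ne_eq, not_not]
  grind

lemma isCut_bot {D : ℕ} (hD : Even D) (j : ℕ) :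
    IsCut (⊥ : Submodule (ZMod 2) (V D)) j ↔ j ≤ D := by
  rw [isCut_iff hD (IsF.zero D)]
  simp [coeff_zero]

lemma isCut_extend_shift {D i : ℕ} {E : Submodule (ZMod 2) (V D)} (hD : Even D) (h1 : 1 ≤ i)
    (h2 : i ≤ D + 2) (hE : IsF D E) (j : ℕ) : IsCut (extend i E) (shift i j) ↔ IsCut E j := by
  rw [isCut_iff (hD.add (by decide)) (hE.extend h1 h2), isCut_iff hD hE]
  have hc : ∀ x c, coeff (ins i x c : V (D + 2)) (shift i j) = coeff x j ∧
      coeff (ins i x c : V (D + 2)) (shift i j + 1) = coeff x (j + 1) := by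
    intro x c
    unfold shift
    split_ifs with h
    · exact ⟨coeff_ins_of_lt h1 h2 _ _ (by omega), coeff_ins_of_lt h1 h2 _ _ (by omega)⟩
    · refine ⟨?_, coeff_ins_of_gt (j := j + 1) h1 h2 _ _ (by omega)⟩
      exact coeff_ins_of_gt h1 h2 _ _ (by omega)
  constructor
  · rintro ⟨h3, h4⟩
    refine ⟨by unfold shift at h3; split_ifs at h3 <;> omega, fun x hx => ?_⟩
    have := h4 (ins i x 0) (mem_extend.2 ⟨x, hx, 0, rfl⟩)
    rwa [(hc x 0).1, (hc x 0).2] at this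
  · rintro ⟨h3, h4⟩
    refine ⟨by unfold shift; split_ifs <;> omega, fun y hy => ?_⟩
    obtain ⟨x, hx, c, rfl⟩ := mem_extend.1 hy
    rw [(hc x c).1, (hc x c).2]
    exact h4 x hx

lemma IsCut.mem_range_shift {D i : ℕ} {E : Submodule (ZMod 2) (V D)} (hD : Even D) (h1 : 1 ≤ i)
    (h2 : i ≤ D + 2) (hE : IsF D E) {j : ℕ} (h : IsCut (extend i E) j) :
    j ∈ Set.range (shift i) := by
  rw [isCut_iff (hD.add (by decide)) (hE.extend h1 h2)] at h
  have hi := h.2 _ (mem_extend.2 ⟨0, E.zero_mem, 1, rfl⟩)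
  have hself : coeff (ins i (0 : V D) 1) i = 1 := by
    rw [coeff_ins_self h1 h2, coeff_zero, zero_add]
  have hj : j ≠ i := by
    rintro rfl
    rw [hself] at hi
    exact one_ne_zero hi.1
  have hj' : j + 1 ≠ i := by
    rintro rfl
    rw [hself] at hi
    exact one_ne_zero hi.2
  by_cases hlt : j + 2 ≤ i
  · exact ⟨j, if_pos hlt⟩
  · refine ⟨j - 2, ?_⟩
    rw [shift, if_neg (by omega)]
    omega

lemma ncard_isCut {D : ℕ} {E : Submodule (ZMod 2) (V D)} (hD : Even D) (hE : IsF D E) :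
    {j | IsCut E j}.ncard + 2 * Module.finrank (ZMod 2) E = D + 1 := by
  refine IsF.even_induction
    (P := fun D E => {j | IsCut E j}.ncard + 2 * Module.finrank (ZMod 2) E = D + 1) ?_ ?_ hD hE
  · intro D hD
    have : {j | IsCut (⊥ : Submodule (ZMod 2) (V D)) j} = (Finset.range (D + 1) : Set ℕ) := by
      ext j
      simp [isCut_bot hD]
    rw [this, Set.ncard_coe_finset]
    simp
  · intro D i E hD h1 h2 hE ih
    have : {j | IsCut (extend i E) j} = shift i '' {j | IsCut E j} := by
      ext j
      constructor
      · intro h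
        obtain ⟨l, rfl⟩ := IsCut.mem_range_shift hD h1 h2 hE h
        exact ⟨l, (isCut_extend_shift hD h1 h2 hE l).1 h, rfl⟩
      · rintro ⟨l, hl, rfl⟩
        exact (isCut_extend_shift hD h1 h2 hE l).2 hl
    rw [this, Set.ncard_image_of_injective _ (shift_strictMono i).injective, finrank_extend h1 h2]
    omega

lemma two_mul_finrank_le {D : ℕ} {E : Submodule (ZMod 2) (V D)} (hD : Even D) (hE : IsF D E) :
    2 * Module.finrank (ZMod 2) E ≤ D := by
  refine IsF.even_induction
    (P := fun D E => 2 * Module.finrank (ZMod 2) E ≤ D) ?_ ?_ hD hE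
  · simp
  · intro D i E hD h1 h2 hE ih
    rw [finrank_extend h1 h2]
    omega

lemma defect_extend {D i : ℕ} (h1 : 1 ≤ i) (h2 : i ≤ D + 2) (E : Submodule (ZMod 2) (V D)) :
    defect (extend i E) = defect E := by
  rw [defect, defect, finrank_extend h1 h2]
  omega

lemma lt_card_isCut {D : ℕ} {E : Submodule (ZMod 2) (V D)} (hD : Even D) (hE : IsF D E) {c : ℕ}
    (hc : c ≤ defect E) (hf : (Set.ofPred (IsCut E)).Finite) : c < hf.toFinset.card := by
  rw [← Set.ncard_eq_toFinset_card _ hf]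
  have h1 := ncard_isCut hD hE
  have h2 := two_mul_finrank_le hD hE
  change {j | IsCut E j}.ncard + _ = _ at h1
  change c < {j | IsCut E j}.ncard
  unfold defect at hc
  omega

lemma nth_isCut_extend {D i : ℕ} {E : Submodule (ZMod 2) (V D)} (hD : Even D) (h1 : 1 ≤ i)
    (h2 : i ≤ D + 2) (hE : IsF D E) {c : ℕ} (hc : c ≤ defect E) :
    Nat.nth (IsCut (extend i E)) c = shift i (Nat.nth (IsCut E) c) := by
  have := Nat.nth_comp_of_strictMono (p := IsCut (extend i E)) (n := c) (shift_strictMono i)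
    (fun j hj => IsCut.mem_range_shift hD h1 h2 hE hj)
    (fun hf => lt_card_isCut (hD.add (by decide)) (hE.extend h1 h2)
      (by rwa [defect_extend h1 h2]) hf)
  rw [← this]
  simp only [isCut_extend_shift hD h1 h2 hE]

lemma eI_extend {D i : ℕ} {E : Submodule (ZMod 2) (V D)} (hD : Even D) (h1 : 1 ≤ i)
    (h2 : i ≤ D + 2) (hE : IsF D E) {c : ℕ} (hc : c ≤ defect E) :
    eI (extend i E) c = T D i (eI E c) := by
  have hcut : IsCut E (Nat.nth (IsCut E) c) := Nat.nth_mem c (lt_card_isCut hD hE hc)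
  rw [eI, eI, nth_isCut_extend hD h1 h2 hE hc, nth_isCut_extend hD h1 h2 hE (by omega),
    T_eInt h1 h2 hcut.1]

/-- The coefficient `ε^c(B^*)` for `B = {[1, Δ], …, [k, Δ+1-k]}`, the primitive set of intervals. -/
def primCoeff (Δ k c : ℕ) : ZMod 2 := epsCoeff ((prim Δ k).image (star Δ)) c

lemma epsVec_apply (Δ k : ℕ) (c : Fin Δ) :
    epsVec Δ ((prim Δ k).image (star Δ)) c = primCoeff Δ k (c + 1) + primCoeff Δ k 0 := by
  have hc := c.2
  rw [← coeff_succ_eq (epsVec Δ _), epsVec, coeff_add, coeff_smul, coeff_sum, coeff_eInt,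
    if_pos (by omega), mul_one, Finset.sum_eq_single ((c : ℕ) + 1)]
  · rw [coeff_smul, coeff_e, if_pos (by omega), mul_one]; rfl
  · intro b _ hb
    rw [coeff_smul, coeff_e, if_neg (by omega), mul_zero]
  · intro h
    exact absurd (Finset.mem_Icc.2 (by omega)) h

lemma vVec_eq {D : ℕ} (E : Submodule (ZMod 2) (V D)) (k : ℕ) :
    vVec E k = ∑ c ∈ Finset.range (defect E),
      (primCoeff (defect E) k (c + 1) + primCoeff (defect E) k 0) • eI E (c + 1) := by
  rw [vVec, tau, Module.Basis.constr_apply_fintype, Finset.sum_range]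
  refine Finset.sum_congr rfl fun c _ => ?_
  rw [← epsVec_apply]
  simp

lemma vVec_extend {D i : ℕ} {E : Submodule (ZMod 2) (V D)} (hD : Even D) (h1 : 1 ≤ i)
    (h2 : i ≤ D + 2) (hE : IsF D E) (k : ℕ) : vVec (extend i E) k = T D i (vVec E k) := by
  rw [vVec_eq, vVec_eq, defect_extend h1 h2, map_sum]
  refine Finset.sum_congr rfl fun c hc => ?_
  rw [map_smul, eI_extend hD h1 h2 hE]
  exact Finset.mem_range.1 hc

lemma mem_coset {D : ℕ} {E : Submodule (ZMod 2) (V D)} {k : ℕ} {x : V D} :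
    x ∈ coset E k ↔ ∃ y ∈ E, y + vVec E k = x := Iff.rfl

/-- The cosets `E + v^k_E` satisfy the same recursion as the subspaces `E`. -/
lemma mem_coset_extend {D i : ℕ} {E : Submodule (ZMod 2) (V D)} (hD : Even D) (h1 : 1 ≤ i)
    (h2 : i ≤ D + 2) (hE : IsF D E) {k : ℕ} {x : V (D + 2)} :
    x ∈ coset (extend i E) k ↔ ∃ x' ∈ coset E k, ∃ c, ins i x' c = x := by
  rw [mem_coset, vVec_extend hD h1 h2 hE]
  have key : ∀ (y : V D) c, ins i y c + T D i (vVec E k) = ins i (y + vVec E k) c := by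
    intro y c
    rw [← ins_zero_right, ← ins_add, add_zero]
  constructor
  · rintro ⟨z, hz, rfl⟩
    obtain ⟨y, hy, c, rfl⟩ := mem_extend.1 hz
    exact ⟨_, ⟨y, hy, rfl⟩, c, (key y c).symm⟩
  · rintro ⟨_, ⟨y, hy, rfl⟩, c, rfl⟩
    exact ⟨_, mem_extend.2 ⟨y, hy, c, rfl⟩, key y c⟩

lemma coeff_vVec_bot {D : ℕ} (hD : Even D) (k : ℕ) {j : ℕ} (h1 : 1 ≤ j) (h2 : j ≤ D) :
    coeff (vVec (⊥ : Submodule (ZMod 2) (V D)) k) j = primCoeff D k j + primCoeff D k 0 := by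
  have hdef : defect (⊥ : Submodule (ZMod 2) (V D)) = D := by simp [defect]
  have hnth : ∀ c ≤ D, Nat.nth (IsCut (⊥ : Submodule (ZMod 2) (V D))) c = c := fun c hc =>
    Nat.nth_of_forall fun n hn => (isCut_bot hD n).2 (hn.trans hc)
  rw [vVec_eq, hdef, coeff_sum, Finset.sum_eq_single (j - 1)]
  · rw [coeff_smul, eI, hnth _ (by omega), hnth _ (by omega), coeff_eInt, if_pos (by omega),
      mul_one, Nat.sub_add_cancel h1]
  · intro b hb hbj
    rw [Finset.mem_range] at hb
    rw [coeff_smul, eI, hnth _ (by omega), hnth _ (by omega), coeff_eInt, if_neg (by omega),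
      mul_zero]
  · intro h
    exact absurd (Finset.mem_range.2 (by omega)) h

lemma star_Icc {Δ m : ℕ} (hΔ : Even Δ) (h2 : 2 * m ≤ Δ + 2) :
    star Δ (Finset.Icc m (Δ + 1 - m)) =
      Finset.range (Δ + 1) \ Finset.Icc m (Δ + 1 - m) := by
  rw [star, if_neg]
  rw [Nat.card_Icc, Nat.not_odd_iff_even, show Δ + 1 - m + 1 - m = Δ + 2 - 2 * m by omega]
  exact (Nat.even_sub h2).2 (by simp [hΔ, Nat.even_add])

lemma nCount_prim {Δ k c : ℕ} (hΔ : Even Δ) (hk : 2 * k ≤ Δ) (hc : c ≤ Δ) :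
    nCount ((prim Δ k).image (star Δ)) c = k - min c (Δ + 1 - c) := by
  rw [nCount, prim, Finset.image_image, Finset.filter_image, Finset.card_image_of_injOn]
  · have : {m ∈ Finset.Icc 1 k | c ∈ (star Δ ∘ fun m => Finset.Icc m (Δ + 1 - m)) m} =
        Finset.Ioc (min c (Δ + 1 - c)) k := by
      ext m
      simp only [Finset.mem_filter, Finset.mem_Icc, Function.comp_apply, Finset.mem_Ioc]
      constructor
      · rintro ⟨hm, h⟩
        rw [star_Icc hΔ (by omega)] at h
        simp only [Finset.mem_sdiff, Finset.mem_range, Finset.mem_Icc] at h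
        omega
      · rintro ⟨hm, h⟩
        rw [star_Icc hΔ (by omega)]
        simp only [Finset.mem_sdiff, Finset.mem_range, Finset.mem_Icc]
        omega
    rw [this, Nat.card_Ioc]
  · intro m hm n hn h
    simp only [Finset.coe_filter, Finset.mem_Icc, Function.comp_apply, Set.mem_ofPred_eq] at hm hn h
    rw [star_Icc hΔ (by omega), star_Icc hΔ (by omega)] at h
    -- the number `m` lies in exactly those of the complements that belong to larger indices
    have e1 := Finset.ext_iff.1 h m
    have e2 := Finset.ext_iff.1 h n
    simp only [Finset.mem_sdiff, Finset.mem_range, Finset.mem_Icc] at e1 e2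
    omega

lemma primCoeff_eq {Δ k c : ℕ} (hΔ : Even Δ) (hk : 2 * k ≤ Δ) (hc : c ≤ Δ) :
    primCoeff Δ k c =
      (((k - min c (Δ + 1 - c)) * ((k - min c (Δ + 1 - c)) + 1) / 2 : ℕ) : ZMod 2) := by
  rw [primCoeff, epsCoeff, nCount_prim hΔ hk hc]

lemma triangular_succ (n : ℕ) : (((n + 1) * (n + 1 + 1) / 2 : ℕ) : ZMod 2) =
    ((n * (n + 1) / 2 : ℕ) : ZMod 2) + (n + 1 : ℕ) := by
  rw [← Nat.cast_add]
  congr 1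
  rw [show (n + 1) * (n + 1 + 1) = n * (n + 1) + (n + 1) * 2 by ring,
    Nat.add_mul_div_right _ _ (by norm_num)]

/-- Consecutive coordinates of `v^k_0` agree, except at the places `q` near one of the two ends
of `[0, D]` with `q` and `k` of different parity. -/
lemma coeff_vVec_bot_eq_iff {D : ℕ} (hD : Even D) {k q : ℕ} (hk : 2 * k ≤ D) (hq : q ≤ D) :
    coeff (vVec (⊥ : Submodule (ZMod 2) (V D)) k) q =
      coeff (vVec (⊥ : Submodule (ZMod 2) (V D)) k) (q + 1) ↔
      ((k ≤ q ∧ q + k ≤ D) ∨ Even (q + k)) := by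
  set v := vVec (⊥ : Submodule (ZMod 2) (V D)) k
  let t : ℕ → ZMod 2 := fun n => ((n * (n + 1) / 2 : ℕ) : ZMod 2)
  have ht : ∀ n, t (n + 1) = t n + (n + 1 : ℕ) := triangular_succ
  -- also valid at `j = 0` and `j = D + 1`, where both terms cancel
  have hv : ∀ j, j ≤ D + 1 → coeff v j = t (k - min j (D + 1 - j)) + t k := by
    intro j hj
    have h0 : primCoeff D k 0 = t k := by rw [primCoeff_eq hD hk (by omega)]; simp [t]
    by_cases h : 1 ≤ j ∧ j ≤ D
    · rw [coeff_vVec_bot hD k h.1 h.2, h0, primCoeff_eq hD hk h.2]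
    · rw [coeff, dif_neg h, show k - min j (D + 1 - j) = k by omega, CharTwo.add_self_eq_zero]
  rw [hv q (by omega), hv (q + 1) (by omega), add_left_inj]
  rcases Nat.lt_or_ge q k with h | h
  · obtain ⟨n, hn⟩ : ∃ n, k = q + 1 + n := ⟨k - (q + 1), by omega⟩
    rw [show k - min q (D + 1 - q) = n + 1 by omega,
      show k - min (q + 1) (D + 1 - (q + 1)) = n by omega, ht, add_eq_left,
      ZMod.natCast_eq_zero_iff_even, hn]
    rw [show q + (q + 1 + n) = 2 * q + (n + 1) by ring, Nat.even_add (m := 2 * q)]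
    simp only [even_two, Even.mul_right, true_iff]
    constructor
    · exact Or.inr
    · rintro (h | h)
      · omega
      · exact h
  · by_cases h' : q + k ≤ D
    · rw [show k - min q (D + 1 - q) = 0 by omega,
        show k - min (q + 1) (D + 1 - (q + 1)) = 0 by omega]
      simp [h, h']
    · obtain ⟨n, hn⟩ : ∃ n, k + q = D + 1 + n := ⟨k + q - (D + 1), by omega⟩
      rw [show k - min q (D + 1 - q) = n by omega,
        show k - min (q + 1) (D + 1 - (q + 1)) = n + 1 by omega, ht, left_eq_add,
        ZMod.natCast_eq_zero_iff_even, add_comm q k, hn,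
        show D + 1 + n = D + (n + 1) by ring, Nat.even_add (m := D)]
      simp only [hD, true_iff]
      constructor
      · exact Or.inr
      · rintro (h | h)
        · omega
        · exact h

/-! ### The lattice path of a vector -/

/-- The path attached to `x`: at the step from `q` to `q + 1` its height changes by `(-1)^(q+1)` if
`x` has the same coordinate at `q` and at `q + 1`, and by the opposite sign otherwise. -/
def height {D : ℕ} (x : V D) : ℕ → ℤ
  | 0 => 0
  | q + 1 => height x q + (if coeff x q = coeff x (q + 1) then (-1) ^ (q + 1) else -(-1) ^ (q + 1))

lemma height_zero {D : ℕ} (x : V D) : height x 0 = 0 := rfl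

lemma height_succ {D : ℕ} (x : V D) (q : ℕ) : height x (q + 1) = height x q +
    (if coeff x q = coeff x (q + 1) then (-1) ^ (q + 1) else -(-1) ^ (q + 1)) := rfl

lemma height_step {D : ℕ} (x : V D) (q : ℕ) :
    height x (q + 1) = height x q + 1 ∨ height x (q + 1) = height x q - 1 := by
  rw [height_succ]
  rcases neg_one_pow_eq_or ℤ (q + 1) with h | h <;> rw [h] <;> split_ifs <;> omega

/-- Passing from `x` to `T_i x + c e_i` inserts a peak or a valley into the path. -/
lemma height_ins_of_lt {D i n : ℕ} (h1 : 1 ≤ i) (h2 : i ≤ D + 2) (x : V D) (c : ZMod 2)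
    (hn : n < i) : height (ins i x c) n = height x n := by
  induction n with
  | zero => rfl
  | succ n ih =>
    rw [height_succ, height_succ, ih (by omega), coeff_ins_of_lt h1 h2 _ _ hn,
      coeff_ins_of_lt h1 h2 _ _ (by omega)]

lemma height_ins_self {D i : ℕ} (h1 : 1 ≤ i) (h2 : i ≤ D + 2) (x : V D) (c : ZMod 2) :
    height (ins i x c) i = height x (i - 1) + (if c = 0 then (-1) ^ i else -(-1) ^ i) := by
  obtain ⟨i, rfl⟩ : ∃ l, i = l + 1 := ⟨i - 1, by omega⟩
  rw [height_succ, height_ins_of_lt h1 h2 _ _ (by omega), coeff_ins_self h1 h2,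
    coeff_ins_of_lt h1 h2 _ _ (by omega)]
  simp

lemma height_ins_of_gt {D i n : ℕ} (h1 : 1 ≤ i) (h2 : i ≤ D + 2) (x : V D) (c : ZMod 2)
    (hn : i ≤ n + 1) : height (ins i x c) (n + 2) = height x n := by
  induction n, (show i - 1 ≤ n by omega) using Nat.le_induction with
  | base =>
    rw [show i - 1 + 2 = i + 1 by omega, height_succ, height_ins_self h1 h2,
      coeff_ins_self h1 h2, show i + 1 = (i - 1) + 2 by omega,
      coeff_ins_of_gt h1 h2 _ _ (by omega), show i - 1 + 2 = i + 1 by omega, pow_succ]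
    rcases zmod_two_cases c with rfl | rfl <;> simp
  | succ n hle ih =>
    rw [show n + 1 + 2 = n + 2 + 1 by ring, height_succ _ (n + 2), height_succ x n, ih (by omega),
      coeff_ins_of_gt h1 h2 _ _ (by omega), show n + 2 + 1 = n + 1 + 2 by ring,
      coeff_ins_of_gt h1 h2 _ _ (by omega)]
    have : (-1 : ℤ) ^ (n + 1 + 2) = (-1) ^ (n + 1) := by rw [pow_add]; norm_num
    rw [this]

lemma height_ins_end {D i : ℕ} (h1 : 1 ≤ i) (h2 : i ≤ D + 2) (x : V D) (c : ZMod 2) :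
    height (ins i x c) (D + 2 + 1) = height x (D + 1) :=
  height_ins_of_gt h1 h2 x c (by omega)

lemma height_injective {D : ℕ} {x y : V D} (h : ∀ n ≤ D + 1, height x n = height y n) :
    x = y := by
  have key : ∀ j, j ≤ D → coeff x j = coeff y j := by
    intro j
    induction j with
    | zero => intro _; rw [coeff_zero_index, coeff_zero_index]
    | succ j ih =>
      intro hj
      have e := h (j + 1) (by omega)
      rw [height_succ, height_succ, h j (by omega), add_right_inj, ih (by omega)] at e
      have hne : (-1 : ℤ) ^ (j + 1) ≠ -(-1) ^ (j + 1) := by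
        rcases neg_one_pow_eq_or ℤ (j + 1) with h | h <;> rw [h] <;> decide
      rcases zmod_two_cases (coeff y j) with h0 | h0 <;>
      rcases zmod_two_cases (coeff x (j + 1)) with h1 | h1 <;>
      rcases zmod_two_cases (coeff y (j + 1)) with h2 | h2 <;>
      simp_all [eq_comm]
  exact ext_coeff fun j _ hj => key j hj

/-! ### The function `u` read off from the path -/

lemma exists_run_of_start {D : ℕ} {x : V D} {a : ℕ} (ha : coeff x (a + 1) = 1)
    (ha' : coeff x a = 0) : ∃ b, IsRun x (a + 1) b := by
  classical
  have hex : ∃ b, a + 1 ≤ b ∧ coeff x (b + 1) = 0 := by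
    by_cases h : a ≤ D
    · exact ⟨D + 1, by omega, coeff_of_lt _ (by omega)⟩
    · exact ⟨a + 1, le_rfl, coeff_of_lt _ (by omega)⟩
  obtain ⟨h1, h2⟩ := Nat.find_spec hex
  have hall : ∀ j, a + 1 ≤ j → j ≤ Nat.find hex → coeff x j = 1 := by
    intro j hj hjb
    rcases hj.eq_or_lt with rfl | hj
    · exact ha
    · have := Nat.find_min hex (show j - 1 < Nat.find hex by omega)
      rw [not_and, Nat.sub_add_cancel (by omega)] at this
      exact (zmod_two_cases _).resolve_left (this (by omega))
  refine ⟨Nat.find hex, by omega, h1, ?_, hall, ha', h2⟩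
  by_contra hcon
  have := hall _ h1 le_rfl
  rw [coeff_of_lt x (by omega)] at this
  exact zero_ne_one this

lemma exists_run_of_end {D : ℕ} {x : V D} {b : ℕ} (hb : coeff x b = 1)
    (hb' : coeff x (b + 1) = 0) : ∃ a, IsRun x a b := by
  have hex : ∀ c, coeff x c = 1 → ∃ a, 1 ≤ a ∧ a ≤ c ∧ (∀ j, a ≤ j → j ≤ c → coeff x j = 1) ∧
      coeff x (a - 1) = 0 := by
    intro c
    induction c with
    | zero => intro h; rw [coeff_zero_index] at h; exact absurd h zero_ne_one
    | succ c ih =>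
      intro h
      rcases zmod_two_cases (coeff x c) with h0 | h0
      · refine ⟨c + 1, by omega, le_rfl, fun j h1 h2 => ?_, h0⟩
        rwa [show j = c + 1 by omega]
      · obtain ⟨a, ha, hac, hall, ha0⟩ := ih h0
        refine ⟨a, ha, by omega, fun j h1 h2 => ?_, ha0⟩
        rcases h2.eq_or_lt with rfl | h2
        · exact h
        · exact hall j h1 (by omega)
  obtain ⟨a, ha, hab, hall, ha0⟩ := hex b hb
  refine ⟨a, ha, hab, ?_, hall, ha0, hb'⟩
  by_contra hcon
  rw [coeff_of_lt x (by omega)] at hb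
  exact zero_ne_one hb

lemma IsRun.right_unique {D : ℕ} {x : V D} {a b c : ℕ} (h : IsRun x a b) (h' : IsRun x a c) :
    b = c := by
  obtain ⟨h1, h2, h3, h4, h5, h6⟩ := h
  obtain ⟨g1, g2, g3, g4, g5, g6⟩ := h'
  rcases lt_trichotomy b c with h | h | h
  · have := g4 (b + 1) (by omega) (by omega)
    rw [h6] at this; exact absurd this zero_ne_one
  · exact h
  · have := h4 (c + 1) (by omega) (by omega)
    rw [g6] at this; exact absurd this zero_ne_one

lemma IsRun.left_unique {D : ℕ} {x : V D} {a b c : ℕ} (h : IsRun x a c) (h' : IsRun x b c) :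
    a = b := by
  obtain ⟨h1, h2, h3, h4, h5, h6⟩ := h
  obtain ⟨g1, g2, g3, g4, g5, g6⟩ := h'
  rcases lt_trichotomy a b with h | h | h
  · have := h4 (b - 1) (by omega) (by omega)
    rw [g5] at this; exact absurd this zero_ne_one
  · exact h
  · have := g4 (a - 1) (by omega) (by omega)
    rw [h5] at this; exact absurd this zero_ne_one

/-- Twice `u(x)` is the sum of the signs `(-1)^q` over the places where `x` changes: a run
`[a, b]` contributes `(-1)^a + (-1)^(b+1)`, which vanishes when `a` and `b` have the same parity. -/
lemma two_mul_u {D : ℕ} (x : V D) :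
    2 * u x = ∑ q ∈ Finset.range (D + 1),
      if coeff x q = coeff x (q + 1) then 0 else (-1 : ℤ) ^ (q + 1) := by
  classical
  set R := (Finset.Icc 1 D ×ˢ Finset.Icc 1 D).filter (fun p => IsRun x p.1 p.2) with hR
  have hmem : ∀ p, p ∈ R ↔ IsRun x p.1 p.2 := by
    intro p
    simp only [hR, Finset.mem_filter, Finset.mem_product, Finset.mem_Icc, and_iff_right_iff_imp]
    rintro ⟨h1, h2, h3, -⟩
    omega
  have hL : 2 * u x = ∑ p ∈ R, ((-1 : ℤ) ^ p.1 + (-1) ^ (p.2 + 1)) := by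
    rw [u, ← Finset.filter_filter, ← hR, Finset.sum_filter, Finset.mul_sum]
    refine Finset.sum_congr rfl fun p _ => ?_
    rw [pow_succ, neg_one_pow_eq_pow_mod_two (n := p.1), neg_one_pow_eq_pow_mod_two (n := p.2)]
    rcases Nat.mod_two_eq_zero_or_one p.1 with h | h <;>
    rcases Nat.mod_two_eq_zero_or_one p.2 with h' | h' <;> rw [h, h'] <;> norm_num
  have hA : ∑ p ∈ R, (-1 : ℤ) ^ p.1 = ∑ q ∈ Finset.range (D + 1),
      if coeff x q = 0 ∧ coeff x (q + 1) = 1 then (-1 : ℤ) ^ (q + 1) else 0 := by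
    rw [← Finset.sum_filter]
    refine Finset.sum_bij (fun p _ => p.1 - 1) ?_ ?_ ?_ ?_
    · rintro ⟨a, b⟩ hp
      obtain ⟨h1, h2, h3, h4, h5, h6⟩ := (hmem _).1 hp
      simp only at h1 h2 h3 h4 h5 h6
      simp only [Finset.mem_filter, Finset.mem_range, Nat.sub_add_cancel h1]
      exact ⟨by omega, h5, h4 a le_rfl h2⟩
    · rintro ⟨a, b⟩ hp ⟨c, d⟩ hq h
      have h1 := (hmem _).1 hp
      have h2 := (hmem _).1 hq
      have := h1.1
      have := h2.1
      simp only at h h1 h2 this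
      obtain rfl : a = c := by omega
      rw [h1.right_unique h2]
    · intro q hq
      simp only [Finset.mem_filter, Finset.mem_range] at hq
      obtain ⟨b, hb⟩ := exists_run_of_start hq.2.2 hq.2.1
      exact ⟨(q + 1, b), (hmem _).2 hb, rfl⟩
    · rintro ⟨a, b⟩ hp
      have := ((hmem _).1 hp).1
      simp only at this
      simp only [Nat.sub_add_cancel this]
  have hB : ∑ p ∈ R, (-1 : ℤ) ^ (p.2 + 1) = ∑ q ∈ Finset.range (D + 1),
      if coeff x q = 1 ∧ coeff x (q + 1) = 0 then (-1 : ℤ) ^ (q + 1) else 0 := by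
    rw [← Finset.sum_filter]
    refine Finset.sum_bij (fun p _ => p.2) ?_ ?_ ?_ ?_
    · rintro ⟨a, b⟩ hp
      obtain ⟨h1, h2, h3, h4, h5, h6⟩ := (hmem _).1 hp
      simp only at h1 h2 h3 h4 h5 h6
      simp only [Finset.mem_filter, Finset.mem_range]
      exact ⟨by omega, h4 b h2 le_rfl, h6⟩
    · rintro ⟨a, b⟩ hp ⟨c, d⟩ hq h
      have h1 := (hmem _).1 hp
      have h2 := (hmem _).1 hq
      simp only at h h1 h2
      subst h
      rw [h1.left_unique h2]
    · intro q hq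
      simp only [Finset.mem_filter, Finset.mem_range] at hq
      obtain ⟨a, ha⟩ := exists_run_of_end hq.2.1 hq.2.2
      exact ⟨(a, q), (hmem _).2 ha, rfl⟩
    · intro p _
      rfl
  rw [hL, Finset.sum_add_distrib, hA, hB, ← Finset.sum_add_distrib]
  refine Finset.sum_congr rfl fun q _ => ?_
  rcases zmod_two_cases (coeff x q) with h | h <;>
  rcases zmod_two_cases (coeff x (q + 1)) with h' | h' <;> rw [h, h'] <;> simp

lemma height_end {D : ℕ} (hD : Even D) (x : V D) : height x (D + 1) = -1 - 4 * u x := by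
  have h : ∀ n, height x n = ∑ q ∈ Finset.range n, (-1 : ℤ) ^ (q + 1) -
      2 * ∑ q ∈ Finset.range n,
        if coeff x q = coeff x (q + 1) then 0 else (-1 : ℤ) ^ (q + 1) := by
    intro n
    induction n with
    | zero => simp [height_zero]
    | succ n ih =>
      rw [height_succ, Finset.sum_range_succ, Finset.sum_range_succ, ih]
      split_ifs <;> ring
  have hs : ∑ q ∈ Finset.range (D + 1), (-1 : ℤ) ^ (q + 1) = -1 := by
    simp only [pow_succ, ← Finset.sum_mul, neg_one_geom_sum]
    rw [if_neg (by simpa [Nat.even_add_one] using hD)]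
    norm_num
  rw [h, hs, ← two_mul_u]
  ring

lemma natAbs_height_end {D : ℕ} (hD : Even D) (x : V D) :
    (height x (D + 1)).natAbs = 2 * uTilde x + 1 := by
  rw [height_end hD, uTilde]
  split_ifs <;> omega

lemma height_end_eq {D : ℕ} (hD : Even D) {x y : V D} (h : uTilde x = uTilde y) :
    height x (D + 1) = height y (D + 1) := by
  have h1 := natAbs_height_end hD x
  have h2 := natAbs_height_end hD y
  rw [height_end hD] at h1 h2 ⊢
  rw [height_end hD]
  omega

lemma uTilde_eq_iff {D : ℕ} (hD : Even D) (x : V D) (k : ℕ) :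
    uTilde x = k ↔ (height x (D + 1)).natAbs = 2 * k + 1 := by
  rw [natAbs_height_end hD]
  omega

lemma uTilde_ins {D i : ℕ} (hD : Even D) (h1 : 1 ≤ i) (h2 : i ≤ D + 2) (x : V D) (c : ZMod 2) :
    uTilde (ins i x c) = uTilde x := by
  rw [uTilde_eq_iff (hD.add (by decide)), height_ins_end h1 h2, natAbs_height_end hD]

/-! ### The fibres of `ũ` as unions of cosets -/

/-- The path of `v^k_0` moves `k` steps in one direction, oscillates with period two for
`D + 1 - 2k` steps, and moves on in the original direction for the last `k` steps. -/
lemma height_vVec_bot {D : ℕ} (hD : Even D) {k n : ℕ} (hk : 2 * k ≤ D) (hn : n ≤ D + 1) :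
    height (vVec (⊥ : Submodule (ZMod 2) (V D)) k) n = (-1) ^ (k + 1) *
      ((if n ≤ k then n else if n + k ≤ D + 1 then k + (n - k) % 2
        else n + 2 * k - D : ℕ) : ℤ) := by
  induction n with
  | zero => simp [height_zero]
  | succ q ih =>
    have hiff := coeff_vVec_bot_eq_iff hD hk (show q ≤ D by omega)
    rw [height_succ, ih (by omega)]
    rw [Nat.even_iff] at hiff hD
    have hs : (-1 : ℤ) ^ (q + 1) = if (q + k) % 2 = 0 then (-1) ^ (k + 1) else -(-1) ^ (k + 1) := by
      rw [neg_one_pow_eq_pow_mod_two, neg_one_pow_eq_pow_mod_two (n := k + 1)]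
      rcases Nat.mod_two_eq_zero_or_one q with h | h <;>
      rcases Nat.mod_two_eq_zero_or_one k with h' | h' <;>
      simp [Nat.add_mod, h, h']
    simp only [hiff, hs]
    rcases neg_one_pow_eq_or ℤ (k + 1) with h | h <;> rw [h] <;> split_ifs <;> push_cast <;> omega

lemma uTilde_vVec_bot {D : ℕ} (hD : Even D) {k : ℕ} (hk : 2 * k ≤ D) :
    uTilde (vVec (⊥ : Submodule (ZMod 2) (V D)) k) = k := by
  rw [uTilde_eq_iff hD, height_vVec_bot hD hk le_rfl, Int.natAbs_mul, Int.natAbs_pow]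
  rw [Nat.even_iff] at hD
  simp only [Int.natAbs_neg, Int.natAbs_one, one_pow, one_mul, Int.natAbs_natCast]
  split_ifs <;> omega

lemma uTilde_of_mem_coset {D : ℕ} (hD : Even D) {E : Submodule (ZMod 2) (V D)} (hE : IsF D E)
    {k : ℕ} (hk : 2 * Module.finrank (ZMod 2) E + 2 * k ≤ D) {x : V D} (hx : x ∈ coset E k) :
    uTilde x = k := by
  refine IsF.even_induction (P := fun D E => 2 * Module.finrank (ZMod 2) E + 2 * k ≤ D →
    ∀ x ∈ coset E k, uTilde x = k) ?_ ?_ hD hE hk x hx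
  · rintro D hD hk x ⟨y, hy, rfl⟩
    rw [SetLike.mem_coe, Submodule.mem_bot] at hy
    subst hy
    simp only [zero_add]
    exact uTilde_vVec_bot hD (by omega)
  · rintro D i E hD h1 h2 hE ih hk x hx
    rw [finrank_extend h1 h2] at hk
    obtain ⟨x', hx', c, rfl⟩ := (mem_coset_extend hD h1 h2 hE).1 hx
    rw [uTilde_ins hD h1 h2]
    exact ih (by omega) x' hx'

/-- A vector whose coordinates at `i - 1` and `i + 1` differ for all `i` is determined by this
property. -/
lemma eq_of_alternating {D : ℕ} (hD : Even D) {x y : V D}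
    (hx : ∀ i, 1 ≤ i → i ≤ D → coeff x (i - 1) ≠ coeff x (i + 1))
    (hy : ∀ i, 1 ≤ i → i ≤ D → coeff y (i - 1) ≠ coeff y (i + 1)) : x = y := by
  have hstep : ∀ i, i + 2 ≤ D + 1 →
      (coeff x i = coeff y i ↔ coeff x (i + 2) = coeff y (i + 2)) := by
    intro i hi
    have h1 := hx (i + 1) (by omega) (by omega)
    have h2 := hy (i + 1) (by omega) (by omega)
    simp only [Nat.add_sub_cancel] at h1 h2
    rcases zmod_two_cases (coeff x i) with a | a <;>
    rcases zmod_two_cases (coeff y i) with b | b <;>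
    rcases zmod_two_cases (coeff x (i + 2)) with c | c <;>
    rcases zmod_two_cases (coeff y (i + 2)) with d | d <;>
    simp_all
  have heven : ∀ m, 2 * m ≤ D → coeff x (2 * m) = coeff y (2 * m) := by
    intro m
    induction m with
    | zero => intro _; simp [coeff_zero_index]
    | succ m ih => intro h; exact (hstep (2 * m) (by omega)).1 (ih (by omega))
  -- the odd places are reached from `D + 1`, beyond the end of both vectors
  have hodd : ∀ m, 2 * m ≤ D → coeff x (D + 1 - 2 * m) = coeff y (D + 1 - 2 * m) := by
    intro m
    induction m with
    | zero => intro _; rw [coeff_of_lt x (by omega), coeff_of_lt y (by omega)]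
    | succ m ih =>
      intro h
      refine (hstep _ (by omega)).2 ?_
      rw [show D + 1 - 2 * (m + 1) + 2 = D + 1 - 2 * m by omega]
      exact ih (by omega)
  refine ext_coeff fun j h1 h2 => ?_
  rw [Nat.even_iff] at hD
  rcases Nat.mod_two_eq_zero_or_one j with h | h
  · have := heven (j / 2) (by omega)
    rwa [show 2 * (j / 2) = j by omega] at this
  · have := hodd ((D + 1 - j) / 2) (by omega)
    rwa [show D + 1 - 2 * ((D + 1 - j) / 2) = j by omega] at this

lemma vVec_bot_alternating {D : ℕ} (hD : Even D) {i : ℕ} (h1 : 1 ≤ i) (h2 : i ≤ D) :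
    coeff (vVec (⊥ : Submodule (ZMod 2) (V D)) (D / 2)) (i - 1) ≠
      coeff (vVec (⊥ : Submodule (ZMod 2) (V D)) (D / 2)) (i + 1) := by
  have e1 := coeff_vVec_bot_eq_iff hD (k := D / 2) (q := i - 1) (by omega) (by omega)
  have e2 := coeff_vVec_bot_eq_iff hD (k := D / 2) (q := i) (by omega) (by omega)
  rw [Nat.sub_add_cancel h1] at e1
  rw [Nat.even_iff] at hD e1 e2
  -- of the two neighbouring differences exactly one is nonzero
  have h : ¬ (coeff (vVec (⊥ : Submodule (ZMod 2) (V D)) (D / 2)) (i - 1) =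
      coeff (vVec (⊥ : Submodule (ZMod 2) (V D)) (D / 2)) i ↔
    coeff (vVec (⊥ : Submodule (ZMod 2) (V D)) (D / 2)) i =
      coeff (vVec (⊥ : Submodule (ZMod 2) (V D)) (D / 2)) (i + 1)) := by
    rw [e1, e2]; omega
  intro h'
  rw [h'] at h
  exact h eq_comm

/-- Every `x` lies in a coset of the largest dimension possible for its level: undo
insertions until the coordinates at `i - 1` and `i + 1` differ for all `i`. -/
lemma exists_mem_coset (p : ℕ) : ∀ x : V (2 * p), ∃ E, IsF (2 * p) E ∧
    Module.finrank (ZMod 2) E + uTilde x = p ∧ x ∈ coset E (uTilde x) := by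
  induction p with
  | zero =>
    intro x
    have hx : vVec (⊥ : Submodule (ZMod 2) (V (2 * 0))) 0 = x := by
      funext j; exact absurd j.2 (by omega)
    have hu : uTilde x = 0 := by rw [← hx]; exact uTilde_vVec_bot (by decide) le_rfl
    refine ⟨⊥, IsF.zero _, by rw [hu, finrank_bot], ?_⟩
    rw [hu]
    exact ⟨0, Submodule.zero_mem _, by rw [← hx]; simp⟩
  | succ p ih =>
    intro x
    by_cases h : ∃ i, 1 ≤ i ∧ i ≤ 2 * p + 2 ∧ coeff x (i - 1) = coeff x (i + 1)
    · obtain ⟨i, h1, h2, h⟩ := h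
      obtain ⟨x', c, rfl⟩ := exists_eq_ins h1 h2 x h
      obtain ⟨E, hE, hdim, hmem⟩ := ih x'
      refine ⟨extend i E, hE.extend h1 h2, ?_, ?_⟩
      · have := finrank_extend h1 h2 E
        have := uTilde_ins (by simp) h1 h2 x' c
        change Module.finrank (ZMod 2) (extend i E) + uTilde (ins i x' c) = _
        omega
      · rw [show uTilde (D := 2 * (p + 1)) (ins i x' c) = uTilde x' from
          uTilde_ins (by simp) h1 h2 x' c]
        exact (mem_coset_extend (by simp) h1 h2 hE).2 ⟨x', hmem, c, rfl⟩
    · push Not at h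
      have hD : Even (2 * (p + 1)) := by simp
      have hx : vVec (⊥ : Submodule (ZMod 2) (V (2 * (p + 1)))) (2 * (p + 1) / 2) = x :=
        eq_of_alternating hD (fun i => vVec_bot_alternating hD) h
      have hu : uTilde x = 2 * (p + 1) / 2 := by
        rw [← hx]; exact uTilde_vVec_bot hD (by omega)
      refine ⟨⊥, IsF.zero _, by rw [hu, finrank_bot]; omega, ?_⟩
      rw [hu]
      exact ⟨0, Submodule.zero_mem _, by rw [← hx]; simp⟩

lemma level_eq_iUnion_coset {D : ℕ} (hD : Even D) (k : ℕ) :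
    level D k = ⋃ E ∈ {E : Submodule (ZMod 2) (V D) |
      IsF D E ∧ Module.finrank (ZMod 2) E + k = D / 2}, coset E k := by
  obtain ⟨p, rfl⟩ := hD.exists_two_nsmul
  rw [smul_eq_mul]
  ext x
  simp only [Set.mem_iUnion, exists_prop]
  constructor
  · rintro rfl
    obtain ⟨E, hE, hdim, hmem⟩ := exists_mem_coset p x
    exact ⟨E, ⟨hE, by omega⟩, hmem⟩
  · rintro ⟨E, ⟨hE, hdim⟩, hmem⟩
    exact uTilde_of_mem_coset (by simp) hE (by omega) hmem

/-! ### Peaks of the normalized path -/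

/-- The path of `x`, reflected if necessary so that it ends at the negative height
`-(2 ũ(x) + 1)`. -/
def npath {D : ℕ} (x : V D) (n : ℕ) : ℤ :=
  if height x (D + 1) < 0 then height x n else -height x n

lemma npath_zero {D : ℕ} (x : V D) : npath x 0 = 0 := by simp [npath, height_zero]

lemma npath_end {D : ℕ} (hD : Even D) (x : V D) : npath x (D + 1) = -(2 * uTilde x + 1) := by
  have := natAbs_height_end hD x
  unfold npath
  split_ifs <;> omega

lemma npath_step {D : ℕ} (x : V D) (n : ℕ) :
    npath x (n + 1) = npath x n + 1 ∨ npath x (n + 1) = npath x n - 1 := by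
  have := height_step x n
  unfold npath
  split_ifs <;> omega

lemma npath_ins_of_lt {D i n : ℕ} (h1 : 1 ≤ i) (h2 : i ≤ D + 2) (x : V D) (c : ZMod 2)
    (hn : n < i) : npath (ins i x c) n = npath x n := by
  rw [npath, npath, height_ins_end h1 h2, height_ins_of_lt h1 h2 _ _ hn]

lemma npath_ins_of_gt {D i n : ℕ} (h1 : 1 ≤ i) (h2 : i ≤ D + 2) (x : V D) (c : ZMod 2)
    (hn : i ≤ n + 1) : npath (ins i x c) (n + 2) = npath x n := by
  rw [npath, npath, height_ins_end h1 h2, height_ins_of_gt h1 h2 _ _ hn]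

/-- The two vectors `T_i x + c e_i` have a peak and a valley at `i`, in some order. -/
lemma npath_ins_self_add {D i : ℕ} (h1 : 1 ≤ i) (h2 : i ≤ D + 2) (x : V D) (c : ZMod 2) :
    npath (ins i x c) i + npath (ins i x (c + 1)) i = 2 * npath x (i - 1) := by
  rw [npath, npath, npath, height_ins_end h1 h2, height_ins_end h1 h2, height_ins_self h1 h2,
    height_ins_self h1 h2]
  rcases zmod_two_cases c with rfl | rfl <;> simp [CharTwo.add_self_eq_zero] <;> split_ifs <;> ring

lemma exists_npath_ins_self {D i : ℕ} (h1 : 1 ≤ i) (h2 : i ≤ D + 2) (x : V D) :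
    ∃ c, npath (ins i x c) i = npath x (i - 1) + 1 := by
  have h := npath_ins_self_add h1 h2 x 0
  have hs := npath_step (ins i x 0) (i - 1)
  rw [Nat.sub_add_cancel h1, npath_ins_of_lt (n := i - 1) h1 h2 _ _ (by omega)] at hs
  rcases hs with hs | hs
  · exact ⟨0, hs⟩
  · exact ⟨0 + 1, by omega⟩

/-- The path of `x` has a peak at `i`. -/
def IsPeak {D : ℕ} (x : V D) (i : ℕ) : Prop :=
  1 ≤ i ∧ i ≤ D ∧ npath x i = npath x (i - 1) + 1 ∧ npath x (i + 1) = npath x (i - 1)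

lemma IsPeak.coeff_eq {D : ℕ} {x : V D} {i : ℕ} (h : IsPeak x i) :
    coeff x (i - 1) = coeff x (i + 1) := by
  obtain ⟨h1, -, h3, h4⟩ := h
  obtain ⟨i, rfl⟩ : ∃ l, i = l + 1 := ⟨i - 1, by omega⟩
  have e1 := height_succ x i
  have e2 := height_succ x (i + 1)
  rw [pow_succ] at e2
  simp only [Nat.add_sub_cancel, npath] at h3 h4 ⊢
  rcases neg_one_pow_eq_or ℤ (i + 1) with h | h <;> rw [h] at e1 e2 <;>
  rcases zmod_two_cases (coeff x i) with a | a <;>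
  rcases zmod_two_cases (coeff x (i + 1)) with b | b <;>
  rcases zmod_two_cases (coeff x (i + 1 + 1)) with d | d <;>
  rw [a, b] at e1 <;> rw [b, d] at e2 <;> rw [a, d] <;> simp at e1 e2 ⊢ <;>
  split_ifs at h3 h4 <;> omega

lemma ins_add_e {D i : ℕ} (x : V D) (c : ZMod 2) :
    ins i x c + e (D + 2) i = ins i x (c + 1) := by
  rw [ins, ins, add_smul, one_smul, add_assoc]

lemma uTilde_add_e {D i : ℕ} (hD : Even D) (h1 : 1 ≤ i) (h2 : i ≤ D) {x : V D}
    (h : coeff x (i - 1) = coeff x (i + 1)) : uTilde (x + e D i) = uTilde x := by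
  obtain ⟨D, rfl⟩ : ∃ D', D = D' + 2 := ⟨D - 2, by rw [Nat.even_iff] at hD; omega⟩
  obtain ⟨x, c, rfl⟩ := exists_eq_ins h1 h2 x h
  have hD' : Even D := (Nat.even_add.1 hD).2 (by decide)
  rw [ins_add_e, uTilde_ins hD' h1 h2, uTilde_ins hD' h1 h2]

lemma IsPeak.npath_add_e {D i : ℕ} (hD : Even D) {x : V D} (h : IsPeak x i) (n : ℕ) :
    npath (x + e D i) n = npath x n - if n = i then 2 else 0 := by
  have hc := h.coeff_eq
  obtain ⟨h1, h2, h3, -⟩ := h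
  obtain ⟨D, rfl⟩ : ∃ D', D = D' + 2 := ⟨D - 2, by rw [Nat.even_iff] at hD; omega⟩
  obtain ⟨x, c, rfl⟩ := exists_eq_ins h1 h2 x hc
  rw [ins_add_e]
  rcases lt_trichotomy n i with hn | rfl | hn
  · rw [npath_ins_of_lt h1 h2 _ _ hn, npath_ins_of_lt h1 h2 _ _ hn, if_neg hn.ne, sub_zero]
  · have := npath_ins_self_add h1 h2 x c
    rw [npath_ins_of_lt (n := n - 1) h1 h2 _ _ (by omega)] at h3
    rw [if_pos rfl]
    omega
  · obtain ⟨n, rfl⟩ : ∃ l, n = l + 2 := ⟨n - 2, by omega⟩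
    rw [npath_ins_of_gt h1 h2 _ _ (by omega), npath_ins_of_gt h1 h2 _ _ (by omega),
      if_neg hn.ne', sub_zero]

/-- A property that is inherited by `x + e_i` whenever `x` has the same coordinate at `i - 1` and
`i + 1` passes from `x` to a vector without peaks in the same fibre of `ũ`: turning a peak into a
valley lowers the area under the path. -/
lemma exists_peakless {D : ℕ} (hD : Even D) (P : V D → Prop)
    (hP : ∀ i x, 1 ≤ i → i ≤ D → coeff x (i - 1) = coeff x (i + 1) → P x → P (x + e D i))
    {x : V D} (hx : P x) : ∃ m, P m ∧ uTilde m = uTilde x ∧ ∀ i, ¬ IsPeak m i := by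
  obtain ⟨m, ⟨hm1, hm2⟩, hmin⟩ := Set.exists_min_image {y | P y ∧ uTilde y = uTilde x}
    (fun y => ∑ n ∈ Finset.range (D + 1), npath y n) (Set.toFinite _) ⟨x, hx, rfl⟩
  refine ⟨m, hm1, hm2, fun i hi => ?_⟩
  obtain ⟨h1, h2, -⟩ := id hi
  have := hmin (m + e D i) ⟨hP i m h1 h2 hi.coeff_eq hm1,
    (uTilde_add_e hD h1 h2 hi.coeff_eq).trans hm2⟩
  simp only [hi.npath_add_e hD, Finset.sum_sub_distrib, Finset.sum_ite_eq',
    Finset.mem_range] at this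
  rw [if_pos (by omega)] at this
  omega

lemma npath_ge {D : ℕ} (x : V D) (n l : ℕ) : npath x n - l ≤ npath x (n + l) ∧
    npath x (n + l) ≤ npath x n + l := by
  induction l with
  | zero => simp
  | succ l ih =>
    have := npath_step x (n + l)
    rw [← add_assoc]
    push_cast
    omega

/-- Without peaks, the path rises to its end once it has taken its first step up. -/
lemma npath_of_peakless {D : ℕ} {x : V D} (h : ∀ i, ¬ IsPeak x i) {n : ℕ} (h1 : 1 ≤ n)
    (hup : npath x n = npath x (n - 1) + 1) (l : ℕ) (hl : n + l ≤ D + 1) :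
    npath x (n + l) = npath x (n + l - 1) + 1 := by
  induction l with
  | zero => exact hup
  | succ l ih =>
    have hp := h (n + l)
    have hi := ih (by omega)
    rw [IsPeak] at hp
    have := npath_step x (n + l)
    rw [show n + (l + 1) = n + l + 1 by ring, Nat.add_sub_cancel]
    have h3 : ¬ npath x (n + l + 1) = npath x (n + l - 1) := fun h4 =>
      hp ⟨by omega, by omega, hi, h4⟩
    omega

lemma npath_eq_max_of_peakless {D : ℕ} {x : V D} (h : ∀ i, ¬ IsPeak x i) {n : ℕ}
    (hn : n ≤ D + 1) : npath x n = max (-n : ℤ) (npath x (D + 1) - (D + 1 - n : ℕ)) := by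
  have g1 := (npath_ge x 0 n).1
  have g2 := (npath_ge x n (D + 1 - n)).2
  rw [npath_zero, zero_add] at g1
  rw [show n + (D + 1 - n) = D + 1 by omega] at g2
  suffices hs : npath x n = -n ∨ npath x (D + 1) = npath x n + (D + 1 - n : ℕ) by omega
  by_cases hup : ∃ j, 1 ≤ j ∧ j ≤ n ∧ npath x j = npath x (j - 1) + 1
  · right
    obtain ⟨j, hj1, hjn, hj⟩ := hup
    have : ∀ l, n + l ≤ D + 1 → npath x (n + l) = npath x n + l := by
      intro l
      induction l with
      | zero => simp
      | succ l ih =>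
        intro hl
        have := npath_of_peakless h hj1 hj (n + (l + 1) - j) (by omega)
        rw [show j + (n + (l + 1) - j) = n + l + 1 by omega, Nat.add_sub_cancel,
          ih (by omega)] at this
        rw [← add_assoc, this]
        push_cast
        ring
    have := this (D + 1 - n) (by omega)
    rwa [show n + (D + 1 - n) = D + 1 by omega] at this
  · left
    push Not at hup
    have : ∀ l ≤ n, npath x l = -l := by
      intro l
      induction l with
      | zero => intro _; simp [npath_zero]
      | succ l ih =>
        intro hl
        have h1 := hup (l + 1) (by omega) hl
        have h2 := npath_step x l
        rw [Nat.add_sub_cancel] at h1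
        have := ih (by omega)
        push_cast
        omega
    exact this n le_rfl

/-- Each fibre of `ũ` contains at most one vector without peaks. -/
lemma eq_of_peakless {D : ℕ} (hD : Even D) {x y : V D} (hx : ∀ i, ¬ IsPeak x i)
    (hy : ∀ i, ¬ IsPeak y i) (h : uTilde x = uTilde y) : x = y := by
  have hend := height_end_eq hD h
  apply height_injective
  intro n hn
  have e1 := npath_eq_max_of_peakless hx hn
  have e2 := npath_eq_max_of_peakless hy hn
  rw [npath_end hD, ← h, ← npath_end hD x, ← e1, npath, npath, ← hend] at e2
  split_ifs at e2 <;> omega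

/-! ### The vectors `f^k_E` span -/

lemma f_apply {D : ℕ} (E : Submodule (ZMod 2) (V D)) (k : ℕ) :
    f E k = ∑ v ∈ (coset E k).toFinite.toFinset, Finsupp.single v 1 := by
  rw [f]
  refine Finset.sum_congr ?_ fun _ _ => rfl
  ext v
  simp

lemma f_bot {D : ℕ} (k : ℕ) :
    f (⊥ : Submodule (ZMod 2) (V D)) k = Finsupp.single (vVec ⊥ k) 1 := by
  have : (coset (⊥ : Submodule (ZMod 2) (V D)) k).toFinite.toFinset = {vVec ⊥ k} := by
    ext v
    simp [coset]
  rw [f_apply, this, Finset.sum_singleton]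

/-- The linear map `ℂ[V_D] → ℂ[V_{D+2}]` that sends `x` to the sum of the two vectors
`T_i x + c e_i`. -/
noncomputable def cup (D i : ℕ) : (V D →₀ ℂ) →ₗ[ℂ] (V (D + 2) →₀ ℂ) :=
  Finsupp.lmapDomain ℂ ℂ (fun x => ins i x 0) + Finsupp.lmapDomain ℂ ℂ (fun x => ins i x 1)

lemma cup_single {D i : ℕ} (x : V D) : cup D i (Finsupp.single x 1) =
    Finsupp.single (ins i x 0) 1 + Finsupp.single (ins i x 1) 1 := by
  simp [cup, Finsupp.mapDomain_single]

lemma f_extend {D i : ℕ} {E : Submodule (ZMod 2) (V D)} (hD : Even D) (h1 : 1 ≤ i)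
    (h2 : i ≤ D + 2) (hE : IsF D E) (k : ℕ) : f (extend i E) k = cup D i (f E k) := by
  have hset : (coset (extend i E) k).toFinite.toFinset =
      ((coset E k).toFinite.toFinset ×ˢ (Finset.univ : Finset (ZMod 2))).image
        fun p => ins i p.1 p.2 := by
    ext v
    rw [Set.Finite.mem_toFinset, mem_coset_extend hD h1 h2 hE]
    simp
  rw [f_apply, f_apply, map_sum, hset, Finset.sum_image, Finset.sum_product]
  · refine Finset.sum_congr rfl fun v _ => ?_
    rw [cup_single]
    exact Fin.sum_univ_two (fun c : ZMod 2 => Finsupp.single (ins i v c) (1 : ℂ))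
  · rintro ⟨x, c⟩ - ⟨y, d⟩ - h
    obtain ⟨rfl, rfl⟩ := ins_injective h1 h2 h
    rfl

/-- The span of all `f^k_E` with fixed `k`. -/
noncomputable def fSpan (D k : ℕ) : Submodule ℂ (V D →₀ ℂ) :=
  Submodule.span ℂ ((fun E => f E k) '' {E | IsPair D E k})

lemma cup_mem_fSpan {D i k : ℕ} (hD : Even D) (h1 : 1 ≤ i) (h2 : i ≤ D + 2) {y : V D →₀ ℂ}
    (hy : y ∈ fSpan D k) : cup D i y ∈ fSpan (D + 2) k := by
  have : (fSpan D k).map (cup D i) ≤ fSpan (D + 2) k := by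
    rw [fSpan, Submodule.map_span_le]
    rintro _ ⟨E, ⟨hE, hk⟩, rfl⟩
    refine Submodule.subset_span ⟨extend i E, ⟨hE.extend h1 h2, ?_⟩, f_extend hD h1 h2 hE k⟩
    rw [finrank_extend h1 h2]
    omega
  exact this ⟨y, hy, rfl⟩

/-- Modulo the images of the maps `cup`, which are spanned by induction, all vectors of one fibre of
`ũ` agree up to sign; one of them is `v^k_0`. -/
lemma single_mem_fSpan (p : ℕ) : ∀ x : V (2 * p),
    Finsupp.single x 1 ∈ fSpan (2 * p) (uTilde x) := by
  induction p with
  | zero =>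
    intro x
    have hx : vVec (⊥ : Submodule (ZMod 2) (V (2 * 0))) 0 = x := by
      funext j; exact absurd j.2 (by omega)
    have hu : uTilde x = 0 := by rw [← hx]; exact uTilde_vVec_bot (by decide) le_rfl
    rw [hu]
    exact Submodule.subset_span ⟨⊥, ⟨IsF.zero _, by simp⟩, by rw [← hx]; exact f_bot 0⟩
  | succ p ih =>
    intro x
    have hD : Even (2 * (p + 1)) := by simp
    set k := uTilde x with hk
    set v := vVec (⊥ : Submodule (ZMod 2) (V (2 * (p + 1)))) k with hv
    have hkD : 2 * k ≤ 2 * (p + 1) := by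
      obtain ⟨E, -, h, -⟩ := exists_mem_coset (p + 1) x
      omega
    have hvk : uTilde v = k := uTilde_vVec_bot hD hkD
    have hvmem : Finsupp.single v 1 ∈ fSpan (2 * (p + 1)) k :=
      Submodule.subset_span ⟨⊥, ⟨IsF.zero _, by simpa using hkD⟩, f_bot k⟩
    have hpair : ∀ i (y : V (2 * (p + 1))), 1 ≤ i → i ≤ 2 * (p + 1) →
        coeff y (i - 1) = coeff y (i + 1) → uTilde y = k →
        (Finsupp.single y (1 : ℂ)) + Finsupp.single (y + e _ i) 1 ∈ fSpan (2 * (p + 1)) k := by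
      intro i y h1 h2 hy hyk
      obtain ⟨z, c, rfl⟩ := exists_eq_ins (D := 2 * p) h1 h2 y hy
      have hz : uTilde z = k := by
        rw [← hyk]; exact (uTilde_ins (by simp) h1 h2 z c).symm
      have hcup := cup_mem_fSpan (by simp) h1 h2 (hz ▸ ih z)
      rw [cup_single] at hcup
      rw [show ins i z c + e (2 * (p + 1)) i = ins i z (c + 1) from ins_add_e z c]
      rcases zmod_two_cases c with rfl | rfl
      · rw [zero_add]; exact hcup
      · rw [show (1 : ZMod 2) + 1 = 0 by decide, add_comm (Finsupp.single _ _)]; exact hcup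
    -- membership of `y` in the span is invariant under all moves, hence can be tested on the vector
    -- without peaks
    have hred : ∀ y : V (2 * (p + 1)), uTilde y = k → ∃ m : V (2 * (p + 1)), uTilde m = k ∧
        (∀ i, ¬ IsPeak m i) ∧ (Finsupp.single y (1 : ℂ) ∈ fSpan (2 * (p + 1)) k ↔
          Finsupp.single m (1 : ℂ) ∈ fSpan (2 * (p + 1)) k) := by
      intro y hy
      have hmove : ∀ i (z : V (2 * (p + 1))), 1 ≤ i → i ≤ 2 * (p + 1) →
          coeff z (i - 1) = coeff z (i + 1) →
          (uTilde z = k ∧ (Finsupp.single y (1 : ℂ) ∈ fSpan (2 * (p + 1)) k ↔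
            Finsupp.single z (1 : ℂ) ∈ fSpan (2 * (p + 1)) k)) →
          (uTilde (z + e _ i) = k ∧ (Finsupp.single y (1 : ℂ) ∈ fSpan (2 * (p + 1)) k ↔
            Finsupp.single (z + e _ i) (1 : ℂ) ∈ fSpan (2 * (p + 1)) k)) := by
        rintro i z h1 h2 hz ⟨hzk, hyz⟩
        refine ⟨(uTilde_add_e hD h1 h2 hz).trans hzk, hyz.trans ?_⟩
        have := hpair i z h1 h2 hz hzk
        exact ⟨fun h => (Submodule.add_mem_iff_right _ h).1 this,
          fun h => (Submodule.add_mem_iff_left _ h).1 this⟩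
      obtain ⟨m, ⟨hm, hm'⟩, -, hpk⟩ := exists_peakless hD _ hmove (x := y) ⟨hy, Iff.rfl⟩
      exact ⟨m, hm, hpk, hm'⟩
    obtain ⟨m, hm, hpk, hxm⟩ := hred x rfl
    obtain ⟨m', hm', hpk', hvm'⟩ := hred v hvk
    obtain rfl : m = m' := eq_of_peakless hD hpk hpk' (hm.trans hm'.symm)
    exact hxm.2 (hvm'.1 hvmem)

lemma fSpan_eq_CV {D : ℕ} (hD : Even D) (k : ℕ) : fSpan D k = CV D k := by
  apply le_antisymm
  · rw [fSpan, Submodule.span_le]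
    rintro _ ⟨E, ⟨hE, hk⟩, rfl⟩
    simp only
    rw [f_apply]
    refine Submodule.sum_mem _ fun v hv => ?_
    exact Finsupp.single_mem_supported ℂ 1
      (uTilde_of_mem_coset hD hE hk ((Set.Finite.mem_toFinset _).1 hv))
  · rw [CV, Finsupp.supported_eq_span_single, Submodule.span_le]
    rintro _ ⟨x, hx, rfl⟩
    obtain ⟨p, rfl⟩ := hD.exists_two_nsmul
    obtain rfl : uTilde x = k := hx
    exact single_mem_fSpan p x

/-! ### Counting the pairs `(E, k)` -/

/-- `[a, b]` is an arc of `x` if the normalized path first rises at `a` and comes back for the first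
time to the height it had before after the step `b + 1`. -/
def IsArc {D : ℕ} (x : V D) (a b : ℕ) : Prop :=
  1 ≤ a ∧ a ≤ b ∧ b ≤ D ∧ npath x (b + 1) = npath x (a - 1) ∧
    ∀ j, a ≤ j → j ≤ b → npath x (a - 1) < npath x j

/-- The subspace spanned by the interval vectors `e_[a,b]` of the arcs `[a, b]` of `x`. -/
def arcSpan {D : ℕ} (x : V D) : Submodule (ZMod 2) (V D) :=
  Submodule.span (ZMod 2) {y | ∃ a b, IsArc x a b ∧ y = eInt D a b}

lemma arcSpan_of_peakless {D : ℕ} {x : V D} (h : ∀ i, ¬ IsPeak x i) : arcSpan x = ⊥ := by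
  rw [arcSpan, Submodule.span_eq_bot]
  rintro _ ⟨a, b, ⟨ha, hab, hb, hend, hall⟩, -⟩
  exfalso
  have hstep := npath_step x (a - 1)
  rw [Nat.sub_add_cancel ha] at hstep
  have h1 := hall a le_rfl hab
  have h2 := npath_of_peakless h ha (by omega) (b + 1 - a) (by omega)
  have h3 := hall b hab le_rfl
  rw [show a + (b + 1 - a) = b + 1 by omega, Nat.add_sub_cancel] at h2
  omega

lemma arcSpan_ins {D i : ℕ} (h1 : 1 ≤ i) (h2 : i ≤ D + 2) {x : V D} {c : ZMod 2}
    (hc : npath (ins i x c) i = npath x (i - 1) + 1) :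
    arcSpan (ins i x c) = extend i (arcSpan x) := by
  have hlt : ∀ j, j < i → npath (ins i x c) j = npath x j :=
    fun j hj => npath_ins_of_lt h1 h2 x c hj
  have hgt : ∀ j, i < j → npath (ins i x c) j = npath x (j - 2) := by
    intro j hj
    obtain ⟨j, rfl⟩ : ∃ l, j = l + 2 := ⟨j - 2, by omega⟩
    exact npath_ins_of_gt h1 h2 x c (by omega)
  have hshift : ∀ j, npath (ins i x c) (shift i j) = npath x j := by
    intro j
    unfold shift
    split_ifs with h
    · exact hlt j (by omega)
    · rw [hgt _ (by omega), Nat.add_sub_cancel]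
  have hshift' : ∀ j, npath (ins i x c) (shift i j + 1) = npath x (j + 1) := by
    intro j
    unfold shift
    split_ifs with h
    · exact hlt _ (by omega)
    · rw [hgt _ (by omega)]; rfl
  apply le_antisymm
  · rw [arcSpan, Submodule.span_le]
    rintro _ ⟨a, b, ⟨ha, hab, hb, hend, hall⟩, rfl⟩
    rw [SetLike.mem_coe, mem_extend]
    by_cases hai : a = i
    · -- the path is back to its initial height at `i + 1`, so that the arc is `[i, i]`
      subst hai
      have hb' : b = a := by
        by_contra hne
        have h3 := hall (a + 1) (by omega) (by omega)
        rw [hlt _ (by omega), hgt _ (by omega), show a + 1 - 2 = a - 1 by omega] at h3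
        exact lt_irrefl _ h3
      subst hb'
      exact ⟨0, Submodule.zero_mem _, 1, by simp [ins, e]⟩
    · -- otherwise the arc neither begins nor ends at one of the two inserted steps
      have e0 := hlt (i - 1) (by omega)
      have e1 := hgt (i + 1) (by omega)
      rw [show i + 1 - 2 = i - 1 by omega] at e1
      have hai' : a ≠ i + 1 := by
        rintro rfl
        have h3 := hall (i + 1) le_rfl hab
        rw [Nat.add_sub_cancel] at h3
        omega
      have hbi : b + 1 ≠ i := by
        rintro rfl
        have h3 := hall b hab le_rfl
        rw [Nat.add_sub_cancel] at e0 hc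
        omega
      have hbi' : b ≠ i := by
        rintro rfl
        have h3 := hall (b - 1) (by omega) (by omega)
        omega
      obtain ⟨a', ha'⟩ : ∃ l, shift i l + 1 = a := by
        by_cases h : a < i
        · exact ⟨a - 1, by rw [shift, if_pos (by omega)]; omega⟩
        · exact ⟨a - 3, by rw [shift, if_neg (by omega)]; omega⟩
      obtain ⟨b', hb'⟩ : ∃ l, shift i l = b := by
        by_cases h : b + 2 ≤ i
        · exact ⟨b, by rw [shift, if_pos h]⟩
        · exact ⟨b - 2, by rw [shift, if_neg (by omega)]; omega⟩
      subst ha' hb'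
      have hab' : a' < b' := (shift_strictMono i).lt_iff_lt.1 (by omega)
      have hb'D : b' ≤ D := by
        unfold shift at hb
        split_ifs at hb <;> omega
      refine ⟨eInt D (a' + 1) b', Submodule.subset_span ⟨a' + 1, b', ⟨by omega, by omega, hb'D, ?_,
        ?_⟩, rfl⟩, 0, by rw [ins_zero_right, T_eInt h1 h2 hb'D]⟩
      · rw [Nat.add_sub_cancel, hshift, hshift'] at hend
        rw [hend, Nat.add_sub_cancel]
      · intro j hj hjb
        have h3 := hall (shift i j) ((shift_strictMono i).lt_iff_lt.2 hj)
          ((shift_strictMono i).monotone hjb)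
        rwa [Nat.add_sub_cancel, hshift, hshift] at h3
  · rw [extend, sup_le_iff, Submodule.map_le_iff_le_comap]
    constructor
    · conv_lhs => rw [arcSpan]
      rw [Submodule.span_le]
      rintro _ ⟨a, b, ⟨ha, hab, hb, hend, hall⟩, rfl⟩
      obtain ⟨a, rfl⟩ : ∃ l, a = l + 1 := ⟨a - 1, by omega⟩
      rw [Nat.add_sub_cancel] at hend hall
      rw [SetLike.mem_coe, Submodule.mem_comap, T_eInt h1 h2 hb]
      refine Submodule.subset_span ⟨shift i a + 1, _,
        ⟨by omega, shift_strictMono i hab, ?_, ?_, ?_⟩, rfl⟩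
      · unfold shift; split_ifs <;> omega
      · rw [Nat.add_sub_cancel, hshift, hshift', hend]
      · intro j hj hjb
        rw [Nat.add_sub_cancel, hshift]
        rcases lt_trichotomy j i with h | rfl | h
        · rw [hlt j h]
          exact hall j (by unfold shift at hj; split_ifs at hj <;> omega)
            (by unfold shift at hjb; split_ifs at hjb <;> omega)
        · rw [hc]
          have := hall (j - 1) (by unfold shift at hj; split_ifs at hj <;> omega)
            (by unfold shift at hjb; split_ifs at hjb <;> omega)
          omega
        · rw [hgt j h]
          have e1 : a ≤ j - 2 := by unfold shift at hj; split_ifs at hj <;> omega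
          have e2 : j - 2 ≤ b := by unfold shift at hjb; split_ifs at hjb <;> omega
          rcases e1.eq_or_lt with rfl | e1
          · unfold shift at hj; split_ifs at hj <;> omega
          · exact hall _ e1 e2
    · rw [Submodule.span_singleton_le_iff_mem]
      refine Submodule.subset_span ⟨i, i, ⟨h1, le_rfl, h2, ?_, ?_⟩, rfl⟩
      · rw [hlt (i - 1) (by omega), hgt (i + 1) (by omega)]
        rfl
      · intro j hj hj'
        obtain rfl : j = i := by omega
        rw [hc, hlt _ (by omega)]
        omega

/-- Every pair `(E, k)` is of the form `(arcSpan x, ũ(x))`. -/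
lemma exists_arcSpan_eq {D : ℕ} (hD : Even D) {E : Submodule (ZMod 2) (V D)} {k : ℕ}
    (h : IsPair D E k) : ∃ x : V D, arcSpan x = E ∧ uTilde x = k := by
  refine IsF.even_induction (P := fun D E => 2 * Module.finrank (ZMod 2) E + 2 * k ≤ D →
    ∃ x : V D, arcSpan x = E ∧ uTilde x = k) ?_ ?_ hD h.1 h.2
  · intro D hD hk
    have hv := uTilde_vVec_bot hD (k := k) (by omega)
    obtain ⟨m, -, hm, hpk⟩ := exists_peakless hD (fun _ => True) (fun _ _ _ _ _ _ => trivial)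
      (x := vVec ⊥ k) trivial
    exact ⟨m, arcSpan_of_peakless hpk, hm.trans hv⟩
  · intro D i E hD h1 h2 hE ih hk
    rw [finrank_extend h1 h2] at hk
    obtain ⟨x, rfl, hx⟩ := ih (by omega)
    obtain ⟨c, hc⟩ := exists_npath_ins_self h1 h2 x
    exact ⟨ins i x c, arcSpan_ins h1 h2 hc, (uTilde_ins hD h1 h2 x c).trans hx⟩

instance {D : ℕ} : Finite {p : Submodule (ZMod 2) (V D) × ℕ // IsPair D p.1 p.2} := by
  have : Finite (Submodule (ZMod 2) (V D)) := inferInstance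
  refine Finite.of_injective (β := Submodule (ZMod 2) (V D) × Fin (D + 1))
    (fun p => (p.1.1, ⟨p.1.2, by have := p.2.2; omega⟩)) ?_
  rintro ⟨⟨E, k⟩, h⟩ ⟨⟨E', k'⟩, h'⟩ heq
  simpa using heq

lemma card_pairs_le {D : ℕ} (hD : Even D) :
    Nat.card {p : Submodule (ZMod 2) (V D) × ℕ // IsPair D p.1 p.2} ≤ Nat.card (V D) := by
  choose g hg1 hg2 using
    fun p : {p : Submodule (ZMod 2) (V D) × ℕ // IsPair D p.1 p.2} => exists_arcSpan_eq hD p.2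
  refine Nat.card_le_card_of_injective g fun p q h => ?_
  refine Subtype.ext (Prod.ext ?_ ?_)
  · rw [← hg1 p, h, hg1 q]
  · rw [← hg2 p, h, hg2 q]

lemma span_pairs_eq_top {D : ℕ} (hD : Even D) :
    Submodule.span ℂ (Set.range
      (fun p : {p : Submodule (ZMod 2) (V D) × ℕ // IsPair D p.1 p.2} => f p.1.1 p.1.2)) = ⊤ := by
  rw [eq_top_iff, ← Finsupp.supported_univ (M := ℂ) (R := ℂ), Finsupp.supported_eq_span_single,
    Submodule.span_le]
  rintro _ ⟨x, -, rfl⟩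
  have hx : Finsupp.single x 1 ∈ fSpan D (uTilde x) := by
    rw [fSpan_eq_CV hD]
    exact Finsupp.single_mem_supported ℂ 1 rfl
  refine Submodule.span_mono ?_ hx
  rintro _ ⟨E, hE, rfl⟩
  exact ⟨⟨(E, uTilde x), hE⟩, rfl⟩

lemma linearIndependent_pairs {D : ℕ} (hD : Even D) :
    LinearIndependent ℂ
      (fun p : {p : Submodule (ZMod 2) (V D) × ℕ // IsPair D p.1 p.2} => f p.1.1 p.1.2) := by
  have := Fintype.ofFinite {p : Submodule (ZMod 2) (V D) × ℕ // IsPair D p.1 p.2}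
  refine linearIndependent_of_top_le_span_of_card_le_finrank (span_pairs_eq_top hD).ge ?_
  rw [Module.finrank_finsupp_self, ← Nat.card_eq_fintype_card, ← Nat.card_eq_fintype_card]
  exact card_pairs_le hD

lemma linearIndependent_fixed {D : ℕ} (hD : Even D) (k : ℕ) :
    LinearIndependent ℂ
      (fun E : {E : Submodule (ZMod 2) (V D) // IsPair D E k} => f E.1 k) := by
  let g : {E : Submodule (ZMod 2) (V D) // IsPair D E k} →
      {p : Submodule (ZMod 2) (V D) × ℕ // IsPair D p.1 p.2} := fun E => ⟨(E.1, k), E.2⟩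
  have hg : Function.Injective g := by
    intro E E' h
    have h' : (g E).1.1 = (g E').1.1 := by rw [h]
    exact Subtype.ext h'
  exact (linearIndependent_pairs hD).comp g hg

end ThirdBasis

theorem mainTheorem6 (D : ℕ) (hD : Even D) :
    (∀ k : ℕ,
      LinearIndependent ℂ
        (fun E : {E : Submodule (ZMod 2) (ThirdBasis.V D) // ThirdBasis.IsPair D E k} =>
          ThirdBasis.f E.1 k) ∧
      Submodule.span ℂ (Set.range
        (fun E : {E : Submodule (ZMod 2) (ThirdBasis.V D) // ThirdBasis.IsPair D E k} =>
          ThirdBasis.f E.1 k)) = ThirdBasis.CV D k) ∧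
    (LinearIndependent ℂ
        (fun p : {p : Submodule (ZMod 2) (ThirdBasis.V D) × ℕ // ThirdBasis.IsPair D p.1 p.2} =>
          ThirdBasis.f p.1.1 p.1.2) ∧
      Submodule.span ℂ (Set.range
        (fun p : {p : Submodule (ZMod 2) (ThirdBasis.V D) × ℕ // ThirdBasis.IsPair D p.1 p.2} =>
          ThirdBasis.f p.1.1 p.1.2)) = ⊤) ∧
    (∀ k : ℕ,
      ThirdBasis.level D k =
        ⋃ E ∈ {E : Submodule (ZMod 2) (ThirdBasis.V D) |
            ThirdBasis.IsF D E ∧ Module.finrank (ZMod 2) E + k = D / 2},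
          ThirdBasis.coset E k) := by
  refine ⟨fun k => ⟨?_, ?_⟩, ⟨ThirdBasis.linearIndependent_pairs hD,
    ThirdBasis.span_pairs_eq_top hD⟩, ThirdBasis.level_eq_iUnion_coset hD⟩
  · exact ThirdBasis.linearIndependent_fixed hD k
  · rw [← ThirdBasis.fSpan_eq_CV hD, ThirdBasis.fSpan, Set.image_eq_range]
    rfl
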